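/- Let $z>0$ and $z_r\ge 0$ ($r=0,1,2,\dots$, possibly infinitely many of them non-zero) be real numbers with $$z+\sum_{r\ge0}(r+1)z_r=1,\qquad z=\sum_{r\ge0}\frac{r(r+1)}2\,z_r .$$ Consider the walk on $\mathbb Z^2$ with weights $p_{1,1}=z$, $p_{k,\ell}=z_r$ if $k,\ell\le0$ and $k+\ell+r=0$, and $p_{k,\ell}=0$ otherwise. (If $z_0=0$, i.e. the walk is not lazy, $z>0$ is automatic. Irreducibility is not assumed.) Put $$K(x,y)=xy-\sum_{k,\ell}p_{k,\ell}x^{1-k}y^{1-\ell},\qquad \mathcal S_1=\{x\in\mathbb C:\ \exists\,y,\ K(x,y)=0,\ |x|=|y|\le1\},$$ let $\mathcal S_1^+$ be the interior of the curve $\mathcal S_1$ (the set of points in bounded components of $\mathbb C\setminus\mathcal S_1$), let $\mathcal H^+=\{w\in\mathbb C:\operatorname{Re}w>0\}$, and let $I_0(x)=x+\frac zx-\sum_{r\ge0} z_r x^{r+1}$ for $0<|x|\le1$. Then: 1. $\mathcal S_1$ has exactly two real points, $1$ and another one, $t$. Moreover $t\in[-1,1)$, and $t$ is the unique zero of $I_0'$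 in $[-1,1)$ (at $-1$ the derivative is taken within the closed unit disc). 2. With $A(x)=\dfrac{I_0(x)-I_0(t)}{I_0(x)-I_0(1)}$, the map $\rho(x)=z\sqrt{A(x)}$ (principal branch, with cut along $\mathbb R_-$; at the pole $x=0$ of $I_0$, extended by its limit) is a conformal map from $\mathcal S_1^+$ onto $\mathcal H^+$; one has $0\in\mathcal S_1^+$ and $\rho(0)=\lim_{x\to0}z\sqrt{A(x)}=z$. Moreover $\rho'(0)>0$, so $\rho$ is the unique conformal map $\psi_1$ from $\mathcal S_1^+$ onto $\mathcal H^+$ with $\psi_1(0)=p_{1,1}$ and $\psi_1'(0)>0$. 3. Call $h:\mathbb Z^2\to\mathbb R$ harmonic if $h(i,j)=0$ whenever $i\le0$ or $j\le0$, and $\sum_{k,\ell}p_{k,\ell}h(i+k,j+\ell)=h(i,j)$ for all $i,j\ge1$; its generating function is $\sum_{i,j\ge1}h(i,j)x^{i-1}y^{j-1}$. For every $n\ge1$ the power series expansion at $(0,0)$ of $$\frac{(y-x)\,z^n\bigl(A(x)^{n/2}+(-1)^{n-1}A(y)^{n/2}\bigr)}{xy\,\bigl(I_0(y)-I_0(x)\bigr)}$$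 exists, and is the generating function of a harmonic function. 4. Let $P_n(X)=(X^2-z^2)^{\lfloor n/2\rfloor}X^{n\bmod 2}$. For every $n\ge1$ the function $H_n(x,y)=\dfrac{P_n(\psi_1(x))-P_n(-\psi_1(y))}{K(x,y)}$ is, near $(0,0)$, the sum of its power series, which is the generating function of a harmonic function $h_n$, and explicitly (for $x,y$ non-zero, distinct and near $0$) $$H_n(x,y)=\frac{(y-x)\,z^n\bigl(Q_n(x)+(-1)^{n-1}Q_n(y)\bigr)}{xy\,\bigl(I_0(y)-I_0(x)\bigr)},\qquad Q_n(x)=\bigl(A(x)-1\bigr)^{\lfloor n/2\rfloor}A(x)^{(n\bmod 2)/2}.$$ -/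

import Mathlib

open Filter Topology

noncomputable section

namespace QuadrantWalk

/-- The weights `p_{k,l}` of the model: `z` on the step `(1,1)`, and `z_r` on each of the `r + 1`
steps `(k,l)` with `k ≤ 0`, `l ≤ 0` and `k + l + r = 0`; all other weights vanish. -/
def weight (z : ℝ) (zr : ℕ → ℝ) (k l : ℤ) : ℝ :=
  if k = 1 ∧ l = 1 then z
  else if k ≤ 0 ∧ l ≤ 0 then zr (-(k + l)).toNat
  else 0

/-- The discrete Laplacian `Δ(h)(i,j) = ∑ p_{k,l} h(i+k,j+l) - h(i,j)`. For weights with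
`p_{k,l} = 0` when `k ≥ 2` or `l ≥ 2`, and `h` vanishing off the open quadrant, the sum has only
finitely many non-zero terms. -/
def laplacian (p : ℤ → ℤ → ℝ) (h : ℤ → ℤ → ℝ) (i j : ℤ) : ℝ :=
  (∑' s : ℤ × ℤ, p s.1 s.2 * h (i + s.1) (j + s.2)) - h i j

/-- Discrete harmonic functions of the walk killed when it leaves the quadrant `{1,2,...}²`. -/
def IsQuadrantHarmonic (p : ℤ → ℤ → ℝ) (h : ℤ → ℤ → ℝ) : Prop :=
  (∀ i j : ℤ, i ≤ 0 ∨ j ≤ 0 → h i j = 0) ∧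
    ∀ i j : ℤ, 1 ≤ i → 1 ≤ j → laplacian p h i j = 0

/-- The kernel `K(x,y) = xy - ∑ p_{k,l} x^{1-k} y^{1-l}`. -/
def kernel (p : ℤ → ℤ → ℝ) (x y : ℂ) : ℂ :=
  x * y - ∑' s : ℤ × ℤ, (p s.1 s.2 : ℂ) * x ^ (1 - s.1) * y ^ (1 - s.2)

/-- The curve `S₁`: first projection of `{(x,y) : K(x,y) = 0, |x| = |y| ≤ 1}`. -/
def curveS (p : ℤ → ℤ → ℝ) : Set ℂ :=
  {x | ∃ y : ℂ, kernel p x y = 0 ∧ ‖x‖ = ‖y‖ ∧ ‖x‖ ≤ 1}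

/-- The interior `S₁⁺` of the curve `S₁`: the points off the curve that lie in a bounded connected
component of the complement of the curve. -/
def insideS (p : ℤ → ℤ → ℝ) : Set ℂ :=
  {x | x ∉ curveS p ∧ Bornology.IsBounded (connectedComponentIn (curveS p)ᶜ x)}

/-- The open right half-plane. -/
def rightHalfPlane : Set ℂ := {w | 0 < w.re}

/-- `f` maps `U` conformally onto `V` (biholomorphically). -/
def IsConformalOnto (f : ℂ → ℂ) (U V : Set ℂ) : Prop :=
  DifferentiableOn ℂ f U ∧ Set.BijOn f U V

/-- `ψ` is the conformal mapping `ψ₁` from `S₁⁺` onto the right half-plane, normalized by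
`ψ(0) = p_{1,1}` and `ψ'(0) > 0` (for weights with `p_{1,1} > 0`, when `0 ∈ S₁⁺`). -/
def IsNormalizedMapping (p : ℤ → ℤ → ℝ) (ψ : ℂ → ℂ) : Prop :=
  IsConformalOnto ψ (insideS p) rightHalfPlane ∧ ψ 0 = (p 1 1 : ℂ) ∧
    ∃ c : ℝ, 0 < c ∧ HasDerivAt ψ (c : ℂ) 0

/-- The polynomial `P_n = (X² - q²)^⌊n/2⌋ X^(n mod 2)`, to be used with `q = p_{1,1}`. -/
def polyP (q : ℝ) (n : ℕ) : Polynomial ℝ :=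
  (Polynomial.X ^ 2 - Polynomial.C (q ^ 2)) ^ (n / 2) * Polynomial.X ^ (n % 2)

/-- `I₀(x) = x + z/x - ∑ z_r x^{r+1}`, meaningful for `0 < |x| ≤ 1`. -/
def I0 (z : ℝ) (zr : ℕ → ℝ) (x : ℂ) : ℂ :=
  x + (z : ℂ) / x - ∑' r : ℕ, (zr r : ℂ) * x ^ (r + 1)

/-- The quotient `(I₀(x) - I₀(t)) / (I₀(x) - I₀(1))`, for `x ≠ 0`. -/
def ratio (z : ℝ) (zr : ℕ → ℝ) (t : ℝ) (x : ℂ) : ℂ :=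
  (I0 z zr x - I0 z zr (t : ℂ)) / (I0 z zr x - I0 z zr 1)

/-- `z √((I₀(x) - I₀(t)) / (I₀(x) - I₀(1)))` for `x ≠ 0`; the complex power is the principal one,
with branch cut along the negative real axis. -/
def rhoFormula (z : ℝ) (zr : ℕ → ℝ) (t : ℝ) (x : ℂ) : ℂ :=
  (z : ℂ) * ratio z zr t x ^ (1 / 2 : ℂ)

/-- The map `ρ`. As `I₀` has a pole at `0`, the value `ρ(0) = z √1` is the limit of the formula. -/
def rho (z : ℝ) (zr : ℕ → ℝ) (t : ℝ) : ℂ → ℂ :=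
  Function.update (rhoFormula z zr t) 0 (z : ℂ)

/-- The explicit bivariate function obtained from the monomial `X^n`. -/
def monomialSeries (z : ℝ) (zr : ℕ → ℝ) (t : ℝ) (n : ℕ) (x y : ℂ) : ℂ :=
  (y - x) * (z : ℂ) ^ n *
      (ratio z zr t x ^ ((n : ℂ) / 2) + (-1) ^ (n - 1) * ratio z zr t y ^ ((n : ℂ) / 2)) /
    (x * y * (I0 z zr y - I0 z zr x))

/-- The explicit value of `z^{-n} P_n(ρ(x))`, with `q = z`. -/
def explicitP (z : ℝ) (zr : ℕ → ℝ) (t : ℝ) (n : ℕ) (x : ℂ) : ℂ :=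
  (ratio z zr t x - 1) ^ (n / 2) * ratio z zr t x ^ (((n % 2 : ℕ) : ℂ) / 2)

/-- The explicit bivariate function obtained from the polynomial `P_n`. -/
def polySeries (z : ℝ) (zr : ℕ → ℝ) (t : ℝ) (n : ℕ) (x y : ℂ) : ℂ :=
  (y - x) * (z : ℂ) ^ n *
      (explicitP z zr t n x + (-1) ^ (n - 1) * explicitP z zr t n y) /
    (x * y * (I0 z zr y - I0 z zr x))

/-- The term `h(i,j) x^{i-1} y^{j-1}` of the generating function of `h`, at `(i,j) = m + (1,1)`. -/
def genTerm (h : ℤ → ℤ → ℝ) (x y : ℂ) (m : ℕ × ℕ) : ℂ :=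
  (h ((m.1 : ℤ) + 1) ((m.2 : ℤ) + 1) : ℂ) * x ^ m.1 * y ^ m.2

end QuadrantWalk

end

/-!
Write `T(x,y) = ∑ z_{a+b} x^a y^b` for the generating series of the steps into the negative
quadrant. Then `K(x,y) = xy - z - xy T(x,y)`, and `K(x,y) (y - x) = xy (I₀(y) - I₀(x))`, so that the
function `I₀` of one variable governs the kernel (`IsModel.kernel_eq`, `IsModel.kernel_mul_sub`).

*The curve.* For `|x| = |y| ≤ 1` the kernel vanishes only if `y = x̄`
(`IsModel.eq_conj_of_kernel_eq_zero`): the curve is the set `K(x, x̄) = 0` in the closed unit disc.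
Along each ray from the origin `K(x, x̄) / |x|²` is strictly increasing, by the zero drift
(`IsModel.radialKernel_smul_lt`). Hence the curve is a polar graph, its interior is the star-shaped
domain `K(x, x̄) < 0` (`IsModel.insideS_eq`), and its only real points are `1` and a negative number
`t`. On the real axis `K(x, x) / x²` is the derivative of `I₀`, which identifies `t` as a critical
point.

*The map `ρ`.* Since `Im I₀(x) = Im x · K(x, x̄) / |x|²`, the function `I₀` maps the upper half of
the interior into the lower half-plane. It is injective on the whole upper half of the unit disc,
because in the coordinate `log x`, which ranges over a convex strip, its derivative has positive
imaginary part (`IsModel.injOn_I0_upper`). It is onto because its image in the lower half-plane is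
open and closed (`IsModel.exists_I0_eq_of_im_neg`). With the monotonicity of `I₀` on the two real
segments and the inequality `I₀(t) < I₀(1)`, this shows that `I₀` maps the interior bijectively onto
the complement of `[I₀(t), I₀(1)]` in the Riemann sphere. A Möbius map takes this complement to the
slit plane, and the square root takes the slit plane to a half-plane
(`IsModel.isConformalOnto_rho`). The normalization makes `ρ` unique by the Schwarz lemma
(`eqOn_of_isConformalOnto`).

*The harmonic functions.* For real `f = ∑ α_i x^i` and `g = ∑ β_j y^j`, the equation
`K(x,y) H(x,y) = f(x) - g(y)` determines the coefficients of `H` recursively. They grow at most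
geometrically, and the vanishing of the mixed coefficients of `K H` is exactly harmonicity
(`IsModel.exists_harmonic`). Applied to `f = P(ρ)` and `g = P(-ρ)` for a real polynomial `P`, this
gives the harmonic functions belonging to `X^n` and to `P_n`.
-/

noncomputable section

namespace QuadrantWalk

/-! ### The weights and their generating series -/

/-- The standing assumptions on the weights: total mass one and zero drift. -/
structure IsModel (z : ℝ) (zr : ℕ → ℝ) : Prop where
  pos : 0 < z
  nonneg : ∀ r, 0 ≤ zr r
  mass : HasSum (fun r : ℕ => ((r : ℝ) + 1) * zr r) (1 - z)
  drift : HasSum (fun r : ℕ => zr r * ((r : ℝ) * ((r : ℝ) + 1) / 2)) z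

/-- The generating series `T(x,y) = ∑ z_{a+b} x^a y^b` of the steps into the negative quadrant. -/
def stepSeries (zr : ℕ → ℝ) (x y : ℂ) : ℂ :=
  ∑' m : ℕ × ℕ, (zr (m.1 + m.2) : ℂ) * x ^ m.1 * y ^ m.2

lemma hasSum_prod_of_nonneg {u : ℕ → ℝ} (hu : ∀ r, 0 ≤ u r) {s : ℝ}
    (hs : HasSum (fun r : ℕ => ((r : ℝ) + 1) * u r) s) :
    HasSum (fun m : ℕ × ℕ => u (m.1 + m.2)) s := by
  have key : ∀ r : ℕ, HasSum (fun c : Finset.HasAntidiagonal.antidiagonal r =>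
      u (c.1.1 + c.1.2)) (((r : ℝ) + 1) * u r) := by
    intro r
    have h1 : ∀ c : Finset.HasAntidiagonal.antidiagonal r, u (c.1.1 + c.1.2) = u r := fun c => by
      rw [Finset.HasAntidiagonal.mem_antidiagonal.1 c.2]
    simp only [h1]
    have := hasSum_fintype (fun _ : Finset.HasAntidiagonal.antidiagonal r => u r)
    simpa using this
  rw [← Finset.HasAntidiagonal.sigmaAntidiagonalEquivProd.hasSum_iff]
  refine HasSum.sigma_of_hasSum hs key ?_
  rw [summable_sigma_of_nonneg]
  · refine ⟨fun r => (key r).summable, ?_⟩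
    exact hs.summable.congr fun r => (key r).tsum_eq.symm
  · intro m
    exact hu _

lemma hasSum_antidiagonal_sum {F : ℕ × ℕ → ℂ} (hF : Summable F) :
    HasSum (fun r : ℕ => ∑ m ∈ Finset.HasAntidiagonal.antidiagonal r, F m) (∑' m, F m) := by
  have h1 := (Finset.HasAntidiagonal.sigmaAntidiagonalEquivProd (A := ℕ)).hasSum_iff.2 hF.hasSum
  refine h1.sigma fun r => ?_
  have := hasSum_fintype (fun c : Finset.HasAntidiagonal.antidiagonal r => F c.1)
  rw [Finset.sum_coe_sort (Finset.HasAntidiagonal.antidiagonal r) F] at this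
  exact this

/-- A sum against the weights splits into the contribution of the step `(1,1)` and that of the
steps `(-a,-b)`. -/
lemma hasSum_weight_smul {E : Type*} [NormedAddCommGroup E] [NormedSpace ℝ E] {z : ℝ} {zr : ℕ → ℝ}
    {G : ℤ × ℤ → E} {S : E}
    (hS : HasSum (fun m : ℕ × ℕ => zr (m.1 + m.2) • G (-(m.1 : ℤ), -(m.2 : ℤ))) S) :
    HasSum (fun s : ℤ × ℤ => weight z zr s.1 s.2 • G s) (z • G (1, 1) + S) := by
  let i : ℕ × ℕ → ℤ × ℤ := fun m => (-(m.1 : ℤ), -(m.2 : ℤ))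
  have hi : Function.Injective i := by
    rintro ⟨a, b⟩ ⟨c, d⟩ hh
    simpa [i] using hh
  have h1 : HasSum (fun s : ℤ × ℤ => if s = (1, 1) then z • G (1, 1) else 0) (z • G (1, 1)) :=
    hasSum_ite_eq _ _
  have h2 : HasSum (fun s : ℤ × ℤ => (if s.1 ≤ 0 ∧ s.2 ≤ 0 then
      zr (-(s.1 + s.2)).toNat else 0) • G s) S := by
    rw [← hi.hasSum_iff]
    · refine (congrArg (HasSum · _) (funext fun m => ?_)).mp hS
      have e1 : (-(-(m.1 : ℤ) + -(m.2 : ℤ))).toNat = m.1 + m.2 := by omega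
      simp only [Function.comp, i, e1]
      rw [if_pos (by omega)]
    · rintro ⟨k, l⟩ hkl
      rw [if_neg]
      · simp
      · rintro ⟨hk, hl⟩
        exact hkl ⟨((-k).toNat, (-l).toNat), by ext <;> simp [i] <;> omega⟩
  refine (congrArg (HasSum · _) (funext fun s => ?_)).mp (h1.add h2)
  obtain ⟨k, l⟩ := s
  by_cases hkl : k = 1 ∧ l = 1
  · obtain ⟨rfl, rfl⟩ := hkl
    simp [weight]
  · simp only [weight, if_neg hkl, Prod.mk.injEq]
    split_ifs <;> simp

namespace IsModel

variable {z : ℝ} {zr : ℕ → ℝ}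

lemma hasSum_prod (h : IsModel z zr) : HasSum (fun m : ℕ × ℕ => zr (m.1 + m.2)) (1 - z) :=
  hasSum_prod_of_nonneg h.nonneg h.mass

lemma hasSum_prod_add (h : IsModel z zr) :
    HasSum (fun m : ℕ × ℕ => ((m.1 : ℝ) + m.2) * zr (m.1 + m.2)) (2 * z) := by
  have := hasSum_prod_of_nonneg (u := fun r => (r : ℝ) * zr r)
    (fun r => mul_nonneg (by positivity) (h.nonneg r)) (s := 2 * z)
    ((congrArg (HasSum · _) (funext fun r => by ring)).mp (h.drift.mul_left 2))
  simpa using this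

lemma hasSum_sq (h : IsModel z zr) :
    HasSum (fun r : ℕ => ((r : ℝ) + 1) ^ 2 * zr r) (1 + z) := by
  convert h.mass.add (h.drift.mul_left 2) using 1
  · ext r; ring
  · ring

lemma le_one (h : IsModel z zr) : z ≤ 1 := by
  have := h.mass.nonneg fun r => mul_nonneg (by positivity) (h.nonneg r)
  linarith

lemma norm_term_le (h : IsModel z zr) {x y : ℂ} (hx : ‖x‖ ≤ 1) (hy : ‖y‖ ≤ 1) (m : ℕ × ℕ) :
    ‖(zr (m.1 + m.2) : ℂ) * x ^ m.1 * y ^ m.2‖ ≤ zr (m.1 + m.2) := by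
  rw [norm_mul, norm_mul, norm_pow, norm_pow, Complex.norm_real, Real.norm_of_nonneg (h.nonneg _),
    mul_assoc]
  exact mul_le_of_le_one_right (h.nonneg _) (mul_le_one₀ (pow_le_one₀ (norm_nonneg _) hx)
    (by positivity) (pow_le_one₀ (norm_nonneg _) hy))

lemma summable_norm_term (h : IsModel z zr) {x y : ℂ} (hx : ‖x‖ ≤ 1) (hy : ‖y‖ ≤ 1) :
    Summable fun m : ℕ × ℕ => ‖(zr (m.1 + m.2) : ℂ) * x ^ m.1 * y ^ m.2‖ :=
  Summable.of_nonneg_of_le (fun _ => norm_nonneg _) (h.norm_term_le hx hy) h.hasSum_prod.summable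

lemma hasSum_stepSeries (h : IsModel z zr) {x y : ℂ} (hx : ‖x‖ ≤ 1) (hy : ‖y‖ ≤ 1) :
    HasSum (fun m : ℕ × ℕ => (zr (m.1 + m.2) : ℂ) * x ^ m.1 * y ^ m.2) (stepSeries zr x y) :=
  (h.summable_norm_term hx hy).of_norm.hasSum

lemma norm_stepSeries_le (h : IsModel z zr) {x y : ℂ} (hx : ‖x‖ ≤ 1) (hy : ‖y‖ ≤ 1) :
    ‖stepSeries zr x y‖ ≤ 1 - z :=
  tsum_of_norm_bounded h.hasSum_prod (h.norm_term_le hx hy)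

lemma continuousOn_stepSeries (h : IsModel z zr) :
    ContinuousOn (fun q : ℂ × ℂ => stepSeries zr q.1 q.2)
      (Metric.closedBall 0 1 ×ˢ Metric.closedBall 0 1) := by
  refine continuousOn_tsum (fun m => ?_) h.hasSum_prod.summable fun m q hq => ?_
  · fun_prop
  · exact h.norm_term_le (by simpa using hq.1) (by simpa using hq.2) m

end IsModel

lemma stepSeries_comm (zr : ℕ → ℝ) (x y : ℂ) : stepSeries zr x y = stepSeries zr y x := by
  unfold stepSeries
  rw [← (Equiv.prodComm ℕ ℕ).tsum_eq]
  refine tsum_congr fun m => ?_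
  simp only [Equiv.prodComm_apply, Prod.fst_swap, Prod.snd_swap, add_comm m.2]
  ring

lemma stepSeries_conj (zr : ℕ → ℝ) (x y : ℂ) :
    stepSeries zr (starRingEnd ℂ x) (starRingEnd ℂ y) = starRingEnd ℂ (stepSeries zr x y) := by
  unfold stepSeries
  rw [Complex.conj_tsum]
  simp

lemma I0_conj (z : ℝ) (zr : ℕ → ℝ) (x : ℂ) :
    I0 z zr (starRingEnd ℂ x) = starRingEnd ℂ (I0 z zr x) := by
  unfold I0
  rw [map_sub, Complex.conj_tsum]
  simp

lemma I0_ofReal_im (z : ℝ) (zr : ℕ → ℝ) (s : ℝ) : (I0 z zr (s : ℂ)).im = 0 := by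
  rw [← Complex.conj_eq_iff_im, ← I0_conj, Complex.conj_ofReal]

lemma ofReal_re_I0 (z : ℝ) (zr : ℕ → ℝ) (s : ℝ) : ((I0 z zr (s : ℂ)).re : ℂ) = I0 z zr s :=
  Complex.ext rfl (by simp [I0_ofReal_im])

namespace IsModel

variable {z : ℝ} {zr : ℕ → ℝ}

lemma summable_pow_succ (h : IsModel z zr) {x : ℂ} (hx : ‖x‖ ≤ 1) :
    Summable fun r : ℕ => (zr r : ℂ) * x ^ (r + 1) := by
  refine Summable.of_norm_bounded h.mass.summable fun r => ?_
  rw [norm_mul, norm_pow, Complex.norm_real, Real.norm_of_nonneg (h.nonneg _)]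
  have h1 : ‖x‖ ^ (r + 1) ≤ 1 := pow_le_one₀ (norm_nonneg _) hx
  nlinarith [h.nonneg r, mul_nonneg (Nat.cast_nonneg (α := ℝ) r) (h.nonneg r)]

lemma tsum_pow_succ_sub (h : IsModel z zr) {x y : ℂ} (hx : ‖x‖ ≤ 1) (hy : ‖y‖ ≤ 1) :
    (∑' r : ℕ, (zr r : ℂ) * x ^ (r + 1)) - ∑' r : ℕ, (zr r : ℂ) * y ^ (r + 1) =
      (x - y) * stepSeries zr x y := by
  rw [← (h.summable_pow_succ hx).tsum_sub (h.summable_pow_succ hy)]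
  have h1 := (hasSum_antidiagonal_sum (h.summable_norm_term hx hy).of_norm).mul_left (x - y)
  rw [stepSeries, ← h1.tsum_eq]
  refine tsum_congr fun r => ?_
  have h2 : ∑ m ∈ Finset.HasAntidiagonal.antidiagonal r, (zr (m.1 + m.2) : ℂ) * x ^ m.1 * y ^ m.2 =
      zr r * ∑ i ∈ Finset.range (r + 1), x ^ i * y ^ (r + 1 - 1 - i) := by
    rw [Finset.mul_sum, Finset.Nat.sum_antidiagonal_eq_sum_range_succ_mk]
    refine Finset.sum_congr rfl fun i hi => ?_
    have hi' : i ≤ r := Nat.lt_succ_iff.1 (Finset.mem_range.1 hi)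
    simp [Nat.add_sub_cancel' hi', mul_assoc]
  rw [h2, ← mul_sub, ← geom_sum₂_mul]
  ring

/-- The kernel in terms of the step series. -/
lemma kernel_eq (h : IsModel z zr) {x y : ℂ} (hx : ‖x‖ ≤ 1) (hy : ‖y‖ ≤ 1) :
    kernel (weight z zr) x y = x * y - z - x * y * stepSeries zr x y := by
  have h1 : HasSum (fun m : ℕ × ℕ => zr (m.1 + m.2) •
      (x ^ (1 - -(m.1 : ℤ)) * y ^ (1 - -(m.2 : ℤ)))) (x * y * stepSeries zr x y) := by
    refine (congrArg (HasSum · _) (funext fun m => ?_)).mp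
      ((h.hasSum_stepSeries hx hy).mul_left (x * y))
    have e2 : (1 - -(m.1 : ℤ)) = ((m.1 + 1 : ℕ) : ℤ) := by push_cast; ring
    have e3 : (1 - -(m.2 : ℤ)) = ((m.2 + 1 : ℕ) : ℤ) := by push_cast; ring
    rw [e2, e3, zpow_natCast, zpow_natCast, Complex.real_smul]
    ring
  have h2 := hasSum_weight_smul (z := z) (G := fun s : ℤ × ℤ => x ^ (1 - s.1) * y ^ (1 - s.2)) h1
  rw [kernel, sub_sub]
  congr 1
  rw [← (show z • (x ^ (1 - (1 : ℤ)) * y ^ (1 - (1 : ℤ))) = (z : ℂ) by simp), ← h2.tsum_eq]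
  exact tsum_congr fun s => by rw [Complex.real_smul, mul_assoc]

lemma I0_sub (h : IsModel z zr) {x y : ℂ} (hx : ‖x‖ ≤ 1) (hy : ‖y‖ ≤ 1) (hx0 : x ≠ 0)
    (hy0 : y ≠ 0) :
    I0 z zr x - I0 z zr y = (x - y) * (1 - z / (x * y) - stepSeries zr x y) := by
  have h1 := h.tsum_pow_succ_sub hx hy
  have h2 : (z : ℂ) / x - z / y = - ((x - y) * (z / (x * y))) := by field_simp; ring
  unfold I0
  linear_combination h2 - h1

/-- The kernel factors through the difference of the values of `I₀`. -/
lemma kernel_mul_sub (h : IsModel z zr) {x y : ℂ} (hx : ‖x‖ ≤ 1) (hy : ‖y‖ ≤ 1) (hx0 : x ≠ 0)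
    (hy0 : y ≠ 0) :
    kernel (weight z zr) x y * (y - x) = x * y * (I0 z zr y - I0 z zr x) := by
  rw [h.kernel_eq hx hy, h.I0_sub hy hx hy0 hx0, stepSeries_comm zr y x]
  field_simp

end IsModel

/-! ### The curve and its interior -/

/-- The real number `K(x, x̄) / |x|²`, for `x ≠ 0`; its sign locates `x` with respect to the
curve. -/
def radialKernel (z : ℝ) (zr : ℕ → ℝ) (x : ℂ) : ℝ :=
  1 - z / ‖x‖ ^ 2 - (stepSeries zr x (starRingEnd ℂ x)).re

/-- The real number `K(x, x̄)`. -/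
def diagKernel (z : ℝ) (zr : ℕ → ℝ) (x : ℂ) : ℝ :=
  ‖x‖ ^ 2 - z - ‖x‖ ^ 2 * (stepSeries zr x (starRingEnd ℂ x)).re

/-- The points of the closed unit disc at which `K(x, x̄) < 0`. This turns out to be the interior
of the curve. -/
def starDomain (z : ℝ) (zr : ℕ → ℝ) : Set ℂ := {x | ‖x‖ ≤ 1 ∧ diagKernel z zr x < 0}

lemma diagKernel_eq (z : ℝ) (zr : ℕ → ℝ) {x : ℂ} (hx : x ≠ 0) :
    diagKernel z zr x = ‖x‖ ^ 2 * radialKernel z zr x := by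
  have : ‖x‖ ≠ 0 := norm_ne_zero_iff.2 hx
  unfold diagKernel radialKernel
  field_simp

lemma diagKernel_zero (z : ℝ) (zr : ℕ → ℝ) : diagKernel z zr 0 = -z := by simp [diagKernel]

lemma stepSeries_conj_im (zr : ℕ → ℝ) (x : ℂ) :
    (stepSeries zr x (starRingEnd ℂ x)).im = 0 := by
  rw [← Complex.conj_eq_iff_im, ← stepSeries_conj, Complex.conj_conj, stepSeries_comm]

lemma abs_im_pow_succ_le (v : ℂ) (r : ℕ) : |(v ^ (r + 1)).im| ≤ (r + 1) * ‖v‖ ^ r * |v.im| := by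
  induction r with
  | zero => simp
  | succ r ih =>
    rw [pow_succ, Complex.mul_im]
    have h1 : |(v ^ (r + 1)).re| ≤ ‖v‖ ^ (r + 1) := by
      rw [← norm_pow]; exact Complex.abs_re_le_norm _
    have h2 : |v.re| ≤ ‖v‖ := Complex.abs_re_le_norm _
    calc _ ≤ |(v ^ (r + 1)).re| * |v.im| + |(v ^ (r + 1)).im| * |v.re| := by
          rw [← abs_mul, ← abs_mul]; exact abs_add_le _ _
      _ ≤ ‖v‖ ^ (r + 1) * |v.im| + ((r + 1) * ‖v‖ ^ r * |v.im|) * ‖v‖ := by gcongr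
      _ = _ := by push_cast; ring

lemma abs_im_pow_le {v : ℂ} (hv : ‖v‖ ≤ 1) (r : ℕ) : |(v ^ r).im| ≤ r * |v.im| := by
  rcases r with _ | r
  · simp
  · refine (abs_im_pow_succ_le v r).trans ?_
    have : ‖v‖ ^ r ≤ 1 := pow_le_one₀ (norm_nonneg _) hv
    push_cast
    gcongr
    exact mul_le_of_le_one_right (by positivity) this

namespace IsModel

variable {z : ℝ} {zr : ℕ → ℝ}

lemma kernel_conj (h : IsModel z zr) {x : ℂ} (hx : ‖x‖ ≤ 1) :
    kernel (weight z zr) x (starRingEnd ℂ x) = diagKernel z zr x := by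
  rw [h.kernel_eq hx (by simpa using hx), Complex.mul_conj']
  apply Complex.ext <;> simp [diagKernel, stepSeries_conj_im, ← Complex.ofReal_pow]

lemma kernel_zero_left (h : IsModel z zr) {y : ℂ} (hy : ‖y‖ ≤ 1) :
    kernel (weight z zr) 0 y = -z := by
  rw [h.kernel_eq (by simp) hy]; simp

lemma I0_im (h : IsModel z zr) {x : ℂ} (hx : ‖x‖ ≤ 1) (hx0 : x ≠ 0) :
    (I0 z zr x).im = x.im * radialKernel z zr x := by
  have hx' : ‖starRingEnd ℂ x‖ ≤ 1 := by simpa using hx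
  have h1 := h.I0_sub hx hx' hx0 (by simpa using hx0)
  rw [I0_conj, Complex.sub_conj, Complex.sub_conj, Complex.mul_conj'] at h1
  have h2 : (1 - (z : ℂ) / (‖x‖ : ℂ) ^ 2 - stepSeries zr x (starRingEnd ℂ x)) =
      radialKernel z zr x := by
    apply Complex.ext <;>
      simp [radialKernel, stepSeries_conj_im, ← Complex.ofReal_pow, ← Complex.ofReal_div]
  rw [h2] at h1
  have h3 := congrArg Complex.im h1
  simp at h3
  linarith

lemma hasSum_re (h : IsModel z zr) {x : ℂ} (hx : ‖x‖ ≤ 1) :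
    HasSum (fun m : ℕ × ℕ => zr (m.1 + m.2) * (x ^ m.1 * (starRingEnd ℂ x) ^ m.2).re)
      (stepSeries zr x (starRingEnd ℂ x)).re := by
  have := Complex.hasSum_re (h.hasSum_stepSeries hx (y := starRingEnd ℂ x) (by simpa using hx))
  simpa [mul_assoc] using this

lemma abs_re_conj_pow_le {x : ℂ} (hx : ‖x‖ ≤ 1) (m : ℕ × ℕ) :
    |(x ^ m.1 * (starRingEnd ℂ x) ^ m.2).re| ≤ 1 := by
  refine (Complex.abs_re_le_norm _).trans ?_
  rw [norm_mul, norm_pow, norm_pow, RCLike.norm_conj]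
  exact mul_le_one₀ (pow_le_one₀ (norm_nonneg _) hx)
    (by positivity) (pow_le_one₀ (norm_nonneg _) hx)

/-- Along a ray from the origin, `K(x, x̄) / |x|²` is strictly increasing within the closed disc.
This is where the zero drift enters: the variation of `T(x, x̄)` is bounded by that of
`z / |x|²`. -/
lemma radialKernel_smul_lt (h : IsModel z zr) {x : ℂ} (hx : ‖x‖ ≤ 1) (hx0 : x ≠ 0) {c : ℝ}
    (hc0 : 0 < c) (hc1 : c < 1) : radialKernel z zr (c * x) < radialKernel z zr x := by
  have hcx : ‖(c : ℂ) * x‖ = c * ‖x‖ := by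
    rw [norm_mul, Complex.norm_real, Real.norm_of_nonneg hc0.le]
  have hcx1 : ‖(c : ℂ) * x‖ ≤ 1 := by
    rw [hcx]; exact mul_le_one₀ hc1.le (norm_nonneg _) hx
  have h1 := h.hasSum_re hx
  have h2 := h.hasSum_re hcx1
  have h3 : (stepSeries zr x (starRingEnd ℂ x)).re -
      (stepSeries zr (c * x) (starRingEnd ℂ (c * x))).re ≤ (1 - c) * (2 * z) := by
    refine hasSum_le (fun m => ?_) (h1.sub h2) (h.hasSum_prod_add.mul_left (1 - c))
    have e : ((c * x) ^ m.1 * (starRingEnd ℂ (c * x)) ^ m.2).re =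
        c ^ (m.1 + m.2) * (x ^ m.1 * (starRingEnd ℂ x) ^ m.2).re := by
      rw [← Complex.re_ofReal_mul, map_mul, Complex.conj_ofReal]
      congr 1
      push_cast
      ring
    rw [e, show zr (m.1 + m.2) * (x ^ m.1 * (starRingEnd ℂ x) ^ m.2).re -
      zr (m.1 + m.2) * (c ^ (m.1 + m.2) * (x ^ m.1 * (starRingEnd ℂ x) ^ m.2).re) =
      zr (m.1 + m.2) * ((1 - c ^ (m.1 + m.2)) * (x ^ m.1 * (starRingEnd ℂ x) ^ m.2).re) by ring,
      show (1 - c) * (((m.1 : ℝ) + m.2) * zr (m.1 + m.2)) =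
        zr (m.1 + m.2) * ((1 - c) * ((m.1 : ℝ) + m.2)) by ring]
    refine mul_le_mul_of_nonneg_left ?_ (h.nonneg _)
    have b1 := one_add_mul_le_pow (a := c - 1) (by linarith) (m.1 + m.2)
    have b2 : 0 ≤ 1 - c ^ (m.1 + m.2) := sub_nonneg.2 (pow_le_one₀ hc0.le hc1.le)
    push_cast at b1
    rw [add_sub_cancel] at b1
    have b3 := (abs_le.1 (abs_re_conj_pow_le hx m)).2
    nlinarith
  have hn : 0 < ‖x‖ := norm_pos_iff.2 hx0
  have h4 : (1 - c) * (2 * z) < z / (c * ‖x‖) ^ 2 - z / ‖x‖ ^ 2 := by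
    have e : z / (c * ‖x‖) ^ 2 - z / ‖x‖ ^ 2 = z * (1 - c ^ 2) / (c ^ 2 * ‖x‖ ^ 2) := by
      field_simp
    rw [e, lt_div_iff₀ (by positivity)]
    have b1 : ‖x‖ ^ 2 ≤ 1 := pow_le_one₀ hn.le hx
    have b2 : c ^ 2 * ‖x‖ ^ 2 ≤ c ^ 2 := mul_le_of_le_one_right (by positivity) b1
    have b3 : 0 < z * (1 - c) := mul_pos h.pos (by linarith)
    nlinarith [mul_le_mul_of_nonneg_left b2 b3.le,
      mul_pos b3 (show 0 < 1 + c - 2 * c ^ 2 by nlinarith)]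
  unfold radialKernel
  rw [hcx]
  linarith

lemma radialKernel_nonneg_of_norm_eq_one (h : IsModel z zr) {x : ℂ} (hx : ‖x‖ = 1) :
    0 ≤ radialKernel z zr x := by
  have h1 := (Complex.re_le_norm _).trans
    (h.norm_stepSeries_le hx.le (y := starRingEnd ℂ x) (by simp [hx]))
  unfold radialKernel
  rw [hx]
  simp only [one_pow, div_one]
  linarith

lemma radialKernel_one (h : IsModel z zr) : radialKernel z zr 1 = 0 := by
  have h1 : stepSeries zr 1 1 = ((1 - z : ℝ) : ℂ) := by
    rw [← (Complex.hasSum_ofReal.2 h.hasSum_prod).tsum_eq]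
    simp [stepSeries]
  simp [radialKernel, h1]

/-- On the torus `|x| = |y|` the kernel vanishes only if `y = x̄`. Writing `x y = v²`, the
imaginary part of `K(x,y) / v² = 0` forces `|Re v| ≤ |v|⁴` unless `v` is real, while the real part
forces `|v|⁴ ≤ (Re v)² - (Im v)²`. -/
lemma eq_conj_of_kernel_eq_zero (h : IsModel z zr) {x y : ℂ} (hK : kernel (weight z zr) x y = 0)
    (hxy : ‖x‖ = ‖y‖) (hx : ‖x‖ ≤ 1) : x ≠ 0 ∧ y = starRingEnd ℂ x := by
  have hy : ‖y‖ ≤ 1 := hxy ▸ hx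
  have hx0 : x ≠ 0 := by
    rintro rfl
    rw [h.kernel_zero_left hy] at hK
    simp [h.pos.ne'] at hK
  refine ⟨hx0, ?_⟩
  obtain ⟨v, hv⟩ := IsAlgClosed.exists_pow_nat_eq (x * y) two_pos
  have hvx : ‖v‖ = ‖x‖ := by
    have := congrArg norm hv
    rw [norm_pow, norm_mul, ← hxy, ← sq] at this
    exact (pow_left_inj₀ (norm_nonneg _) (norm_nonneg _) two_ne_zero).1 this
  have hv0 : v ≠ 0 := by
    rw [← norm_ne_zero_iff, hvx]; exact norm_ne_zero_iff.2 hx0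
  have hv1 : ‖v‖ ≤ 1 := hvx ▸ hx
  obtain ⟨w, hw⟩ : ∃ w, w = x / v := ⟨_, rfl⟩
  have hw1 : ‖w‖ = 1 := by
    rw [hw, norm_div, hvx, div_self (norm_ne_zero_iff.2 hx0)]
  have hxw : x = v * w := by rw [hw]; field_simp
  have hww : w * starRingEnd ℂ w = 1 := by simp [Complex.mul_conj', hw1]
  have hyw : y = v * starRingEnd ℂ w := by
    apply mul_left_cancel₀ hx0
    rw [← hv, hxw]
    linear_combination (-v ^ 2) * hww
  let c : ℕ × ℕ → ℝ := fun m => zr (m.1 + m.2) * (w ^ m.1 * (starRingEnd ℂ w) ^ m.2).re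
  have hc : ∀ m, |c m| ≤ zr (m.1 + m.2) := fun m => by
    simp only [c]
    rw [abs_mul, abs_of_nonneg (h.nonneg _)]
    exact mul_le_of_le_one_right (h.nonneg _) (abs_re_conj_pow_le hw1.le m)
  have hT : HasSum (fun m : ℕ × ℕ => (c m : ℂ) * v ^ (m.1 + m.2)) (stepSeries zr x y) := by
    have h1 := h.hasSum_stepSeries hx hy
    have h2 := h.hasSum_stepSeries hy hx
    rw [stepSeries_comm] at h2
    have h3 := (h1.add h2).div_const 2
    rw [add_self_div_two] at h3
    refine (congrArg (HasSum · _) (funext fun m => ?_)).mp h3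
    have e : ((w ^ m.1 * (starRingEnd ℂ w) ^ m.2).re : ℂ) =
        (w ^ m.1 * (starRingEnd ℂ w) ^ m.2 + (starRingEnd ℂ w) ^ m.1 * w ^ m.2) / 2 := by
      rw [Complex.re_eq_add_conj]
      simp
    simp only [c, Complex.ofReal_mul, e, hyw, hxw]
    ring
  rw [h.kernel_eq hx hy, ← hv] at hK
  have hn2 : (0 : ℝ) < v.re ^ 2 + v.im ^ 2 := by
    have := Complex.normSq_pos.2 hv0
    rw [Complex.normSq_apply] at this
    nlinarith
  have hn1 : v.re ^ 2 + v.im ^ 2 ≤ 1 := by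
    have := pow_le_one₀ (n := 2) (norm_nonneg _) hv1
    rw [← Complex.normSq_eq_norm_sq, Complex.normSq_apply] at this
    nlinarith
  have hre := congrArg Complex.re hK
  have him := congrArg Complex.im hK
  obtain ⟨T, hTe⟩ : ∃ T, T = stepSeries zr x y := ⟨_, rfl⟩
  rw [← hTe] at hre him hT
  simp only [sq, Complex.sub_re, Complex.sub_im, Complex.mul_re, Complex.mul_im,
    Complex.ofReal_re, Complex.ofReal_im, Complex.zero_re, Complex.zero_im] at hre him
  obtain ⟨p, hp⟩ : ∃ p, p = v.re := ⟨_, rfl⟩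
  obtain ⟨q, hq⟩ : ∃ q, q = v.im := ⟨_, rfl⟩
  rw [← hp, ← hq] at hre him hn1 hn2
  have hTim : |T.im| ≤ 2 * z * |q| := by
    have h1 := Complex.hasSum_im hT
    have h2 := h.hasSum_prod_add.mul_right |q|
    rw [← h1.tsum_eq]
    refine tsum_of_norm_bounded (f := fun m : ℕ × ℕ => ((c m : ℂ) * v ^ (m.1 + m.2)).im) h2
      fun m => ?_
    rw [Complex.im_ofReal_mul, Real.norm_eq_abs, abs_mul]
    have b := abs_im_pow_le hv1 (m.1 + m.2)
    rw [← hq] at b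
    calc _ ≤ zr (m.1 + m.2) * ((m.1 + m.2 : ℕ) * |q|) :=
          mul_le_mul (hc m) b (abs_nonneg _) (h.nonneg _)
      _ = _ := by push_cast; ring
  have hTre : T.re ≤ 1 - z := by
    rw [hTe]; exact (Complex.re_le_norm _).trans (h.norm_stepSeries_le hx hy)
  -- both parts of the equation `T = 1 - z / v²`
  have e1 : (p ^ 2 + q ^ 2) ^ 2 * T.im = z * (2 * p * q) := by
    linear_combination (2 * p * q) * hre - (p ^ 2 - q ^ 2) * him
  have e2 : (p ^ 2 + q ^ 2) ^ 2 * (1 - T.re) = z * (p ^ 2 - q ^ 2) := by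
    linear_combination (p ^ 2 - q ^ 2) * hre + (2 * p * q) * him
  have hz := h.pos
  have f2 : (p ^ 2 + q ^ 2) ^ 2 ≤ p ^ 2 - q ^ 2 := by
    have : (p ^ 2 + q ^ 2) ^ 2 * z ≤ (p ^ 2 + q ^ 2) ^ 2 * (1 - T.re) :=
      mul_le_mul_of_nonneg_left (by linarith) (by positivity)
    rw [e2, mul_comm] at this
    exact le_of_mul_le_mul_left this hz
  have hq0 : q = 0 := by
    by_contra hq0
    have hqa : 0 < |q| := abs_pos.2 hq0
    have f1 : |p| ≤ (p ^ 2 + q ^ 2) ^ 2 := by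
      have b1 := congrArg abs e1
      rw [abs_mul, abs_mul, abs_mul, abs_mul, abs_of_pos hz, abs_two,
        abs_of_nonneg (by positivity : 0 ≤ (p ^ 2 + q ^ 2) ^ 2)] at b1
      have b2 : (p ^ 2 + q ^ 2) ^ 2 * |T.im| ≤ (p ^ 2 + q ^ 2) ^ 2 * (2 * z * |q|) :=
        mul_le_mul_of_nonneg_left hTim (by positivity)
      rw [b1] at b2
      have b3 : (2 * z * |q|) * |p| ≤ (2 * z * |q|) * (p ^ 2 + q ^ 2) ^ 2 := by linarith
      exact le_of_mul_le_mul_left b3 (by positivity)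
    have f3 : p ^ 2 ≤ ((p ^ 2 + q ^ 2) ^ 2) ^ 2 := by
      rw [← sq_abs p]
      exact pow_le_pow_left₀ (abs_nonneg _) (by simpa using f1) 2
    have f4 : ((p ^ 2 + q ^ 2) ^ 2) ^ 2 ≤ (p ^ 2 + q ^ 2) ^ 2 :=
      pow_le_of_le_one (by positivity) (pow_le_one₀ (by positivity) hn1) two_ne_zero
    have f5 : 0 < q ^ 2 := by positivity
    linarith
  apply mul_left_cancel₀ hx0
  rw [← hv, Complex.mul_conj', ← hvx, ← Complex.mul_conj',
    show starRingEnd ℂ v = v from Complex.conj_eq_iff_im.2 (by rw [← hq, hq0]), sq]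

lemma mem_curveS (h : IsModel z zr) {x : ℂ} :
    x ∈ curveS (weight z zr) ↔ ‖x‖ ≤ 1 ∧ diagKernel z zr x = 0 := by
  constructor
  · rintro ⟨y, hK, hxy, hx⟩
    obtain ⟨-, rfl⟩ := h.eq_conj_of_kernel_eq_zero hK hxy hx
    rw [h.kernel_conj hx] at hK
    exact ⟨hx, by exact_mod_cast hK⟩
  · rintro ⟨hx, h0⟩
    exact ⟨starRingEnd ℂ x, by rw [h.kernel_conj hx, h0, Complex.ofReal_zero], by simp, hx⟩

lemma diagKernel_nonneg_of_norm_eq_one (h : IsModel z zr) {x : ℂ} (hx : ‖x‖ = 1) :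
    0 ≤ diagKernel z zr x := by
  rw [diagKernel_eq z zr (by rintro rfl; simp at hx)]
  exact mul_nonneg (by positivity) (h.radialKernel_nonneg_of_norm_eq_one hx)

lemma ne_zero_of_diagKernel_nonneg (h : IsModel z zr) {x : ℂ} (hx : 0 ≤ diagKernel z zr x) :
    x ≠ 0 := by
  rintro rfl
  rw [diagKernel_zero] at hx
  linarith [h.pos]

lemma norm_lt_one_of_mem (h : IsModel z zr) {x : ℂ} (hx : x ∈ starDomain z zr) : ‖x‖ < 1 := by
  refine lt_of_le_of_ne hx.1 fun h1 => ?_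
  exact absurd hx.2 (not_lt.2 (h.diagKernel_nonneg_of_norm_eq_one h1))

lemma continuousOn_diagKernel (h : IsModel z zr) :
    ContinuousOn (diagKernel z zr) (Metric.closedBall 0 1) := by
  have h1 : ContinuousOn (fun x : ℂ => stepSeries zr x (starRingEnd ℂ x))
      (Metric.closedBall 0 1) :=
    h.continuousOn_stepSeries.comp (f := fun x : ℂ => (x, starRingEnd ℂ x))
      (continuous_id.prodMk Complex.continuous_conj).continuousOn
      (fun x hx => ⟨hx, by simpa using hx⟩)
  have h2 := Complex.continuous_re.comp_continuousOn h1
  have h3 : ContinuousOn (fun x : ℂ => ‖x‖ ^ 2) (Metric.closedBall 0 1) := by fun_prop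
  exact (h3.sub continuousOn_const).sub (h3.mul h2)

lemma isOpen_starDomain (h : IsModel z zr) : IsOpen (starDomain z zr) := by
  have : starDomain z zr = Metric.ball 0 1 ∩ diagKernel z zr ⁻¹' Set.Iio 0 := by
    ext x
    refine ⟨fun hx => ⟨by simpa using h.norm_lt_one_of_mem hx, hx.2⟩, fun hx => ⟨?_, hx.2⟩⟩
    have : ‖x‖ < 1 := by simpa using hx.1
    exact this.le
  rw [this]
  exact (h.continuousOn_diagKernel.mono Metric.ball_subset_closedBall).isOpen_inter_preimage
    Metric.isOpen_ball isOpen_Iio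

lemma zero_mem_starDomain (h : IsModel z zr) : (0 : ℂ) ∈ starDomain z zr := by
  simp [starDomain, diagKernel_zero, h.pos]

lemma mem_starDomain_iff {x : ℂ} (hx0 : x ≠ 0) :
    x ∈ starDomain z zr ↔ ‖x‖ ≤ 1 ∧ radialKernel z zr x < 0 := by
  have : 0 < ‖x‖ := norm_pos_iff.2 hx0
  rw [starDomain, Set.mem_ofPred_eq, diagKernel_eq z zr hx0, mul_neg_iff]
  constructor
  · rintro ⟨h1, ⟨-, h2⟩ | ⟨h2, -⟩⟩
    · exact ⟨h1, h2⟩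
    · exact absurd h2 (not_lt.2 (by positivity))
  · rintro ⟨h1, h2⟩
    exact ⟨h1, Or.inl ⟨by positivity, h2⟩⟩

lemma smul_mem_starDomain (h : IsModel z zr) {x : ℂ} (hx : x ∈ starDomain z zr) {c : ℝ}
    (hc0 : 0 ≤ c) (hc1 : c ≤ 1) : (c : ℂ) * x ∈ starDomain z zr := by
  rcases eq_or_ne x 0 with rfl | hx0
  · simpa using hx
  rcases hc0.eq_or_lt with rfl | hc0
  · simpa using h.zero_mem_starDomain
  rcases hc1.eq_or_lt with rfl | hc1
  · simpa using hx
  have hx' := (mem_starDomain_iff hx0).1 hx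
  rw [mem_starDomain_iff (mul_ne_zero (by exact_mod_cast hc0.ne') hx0)]
  refine ⟨?_, (h.radialKernel_smul_lt hx'.1 hx0 hc0 hc1).trans hx'.2⟩
  rw [norm_mul, Complex.norm_real, Real.norm_of_nonneg hc0.le]
  exact mul_le_one₀ hc1.le (norm_nonneg _) hx'.1

/-- The interior of the curve is the domain `{x | |x| ≤ 1, K(x, x̄) < 0}`: the latter is
bounded, and open and closed in the complement of the curve, while from every other point off the
curve the ray pointing away from the origin avoids the curve. -/
lemma insideS_eq (h : IsModel z zr) : insideS (weight z zr) = starDomain z zr := by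
  ext x
  constructor
  · rintro ⟨hx, hb⟩
    by_contra hxD
    have hpos : ‖x‖ ≤ 1 → 0 < diagKernel z zr x := fun h1 => by
      rcases lt_trichotomy (diagKernel z zr x) 0 with h2 | h2 | h2
      · exact absurd ⟨h1, h2⟩ hxD
      · exact absurd (h.mem_curveS.2 ⟨h1, h2⟩) hx
      · exact h2
    have hx0 : x ≠ 0 := by
      rintro rfl
      exact hxD h.zero_mem_starDomain
    have hray : (fun c : ℝ => (c : ℂ) * x) '' Set.Ici 1 ⊆ (curveS (weight z zr))ᶜ := by
      rintro _ ⟨c, hc, rfl⟩ hcx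
      have hc : 1 ≤ c := hc
      have hc0 : 0 < c := by linarith
      obtain ⟨h1, h2⟩ := h.mem_curveS.1 hcx
      have h1' := h1
      rw [norm_mul, Complex.norm_real, Real.norm_of_nonneg hc0.le] at h1'
      have hx1 : ‖x‖ ≤ 1 := (le_mul_of_one_le_left (norm_nonneg _) hc).trans h1'
      have h3 := hpos hx1
      rcases hc.eq_or_lt with rfl | hc
      · simp at h2
        exact h3.ne' h2
      have hcx0 : (c : ℂ) * x ≠ 0 := mul_ne_zero (by exact_mod_cast hc0.ne') hx0
      have h4 := h.radialKernel_smul_lt h1 hcx0 (inv_pos.2 hc0) (inv_lt_one_of_one_lt₀ hc)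
      rw [← mul_assoc, ← Complex.ofReal_mul, inv_mul_cancel₀ hc0.ne', Complex.ofReal_one,
        one_mul] at h4
      rw [diagKernel_eq z zr hcx0] at h2
      rw [diagKernel_eq z zr hx0] at h3
      have h5 : radialKernel z zr (c * x) = 0 :=
        (mul_eq_zero.1 h2).resolve_left (pow_ne_zero _ (norm_ne_zero_iff.2 hcx0))
      have h6 : 0 < radialKernel z zr x := pos_of_mul_pos_right h3 (by positivity)
      linarith
    have hpre : IsPreconnected ((fun c : ℝ => (c : ℂ) * x) '' Set.Ici 1) :=
      isPreconnected_Ici.image _ (by fun_prop)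
    have hsub := hpre.subset_connectedComponentIn (x := x) ⟨1, Set.self_mem_Ici, by simp⟩ hray
    obtain ⟨R, hR⟩ := (hb.subset hsub).exists_norm_le
    have hn : 0 < ‖x‖ := norm_pos_iff.2 hx0
    have h1 := hR _ ⟨max 1 ((|R| + 1) / ‖x‖), Set.mem_Ici.2 (le_max_left _ _), rfl⟩
    rw [norm_mul, Complex.norm_real, Real.norm_of_nonneg (by positivity)] at h1
    have h2 : (|R| + 1) / ‖x‖ * ‖x‖ ≤ max 1 ((|R| + 1) / ‖x‖) * ‖x‖ := by
      gcongr; exact le_max_right _ _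
    rw [div_mul_cancel₀ _ hn.ne'] at h2
    linarith [le_abs_self R]
  · intro hx
    refine ⟨fun hc => absurd (h.mem_curveS.1 hc).2 hx.2.ne, ?_⟩
    refine Metric.isBounded_closedBall (x := (0 : ℂ)) (r := 1) |>.subset ?_
    have hsub : connectedComponentIn (curveS (weight z zr))ᶜ x ⊆ starDomain z zr := by
      have hxc : x ∈ (curveS (weight z zr))ᶜ := fun hc => absurd (h.mem_curveS.1 hc).2 hx.2.ne
      refine isPreconnected_connectedComponentIn.subset_of_closure_inter_subset
        h.isOpen_starDomain ⟨x, mem_connectedComponentIn hxc, hx⟩ ?_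
      rintro y ⟨hy, hyc⟩
      have hyc' : y ∉ curveS (weight z zr) := connectedComponentIn_subset _ _ hyc
      have hcl : IsClosed (Metric.closedBall (0 : ℂ) 1 ∩ diagKernel z zr ⁻¹' Set.Iic 0) :=
        h.continuousOn_diagKernel.preimage_isClosed_of_isClosed Metric.isClosed_closedBall
          isClosed_Iic
      have hy2 := closure_minimal (t := Metric.closedBall (0 : ℂ) 1 ∩ diagKernel z zr ⁻¹' Set.Iic 0)
        (fun w hw => ⟨by simpa using hw.1, hw.2.le⟩) hcl hy
      have hy1 : ‖y‖ ≤ 1 := by simpa using hy2.1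
      exact ⟨hy1, lt_of_le_of_ne hy2.2 fun h0 => hyc' (h.mem_curveS.2 ⟨hy1, h0⟩)⟩
    exact fun y hy => by simpa using (hsub hy).1

/-- The curve meets each open ray from the origin at most once. -/
lemma eq_of_mem_curveS_ray (h : IsModel z zr) {x : ℂ} {c : ℝ} (hc : 0 < c)
    (hx : x ∈ curveS (weight z zr)) (hcx : (c : ℂ) * x ∈ curveS (weight z zr)) : c = 1 := by
  obtain ⟨h1, h2⟩ := h.mem_curveS.1 hx
  obtain ⟨h3, h4⟩ := h.mem_curveS.1 hcx
  have hx0 : x ≠ 0 := h.ne_zero_of_diagKernel_nonneg h2.ge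
  have hcx0 : (c : ℂ) * x ≠ 0 := h.ne_zero_of_diagKernel_nonneg h4.ge
  rw [diagKernel_eq z zr hx0, mul_eq_zero,
    or_iff_right (pow_ne_zero _ (norm_ne_zero_iff.2 hx0))] at h2
  rw [diagKernel_eq z zr hcx0, mul_eq_zero,
    or_iff_right (pow_ne_zero _ (norm_ne_zero_iff.2 hcx0))] at h4
  rcases lt_trichotomy c 1 with h5 | h5 | h5
  · have := h.radialKernel_smul_lt h1 hx0 hc h5
    linarith
  · exact h5
  · have := h.radialKernel_smul_lt h3 hcx0 (inv_pos.2 hc) (inv_lt_one_of_one_lt₀ h5)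
    rw [← mul_assoc, ← Complex.ofReal_mul, inv_mul_cancel₀ hc.ne', Complex.ofReal_one,
        one_mul] at this
    linarith

lemma one_mem_curveS (h : IsModel z zr) : (1 : ℂ) ∈ curveS (weight z zr) := by
  rw [h.mem_curveS, diagKernel_eq z zr one_ne_zero, h.radialKernel_one]
  simp

/-- The second real point of the curve. -/
lemma exists_neg_mem_curveS (h : IsModel z zr) :
    ∃ t : ℝ, -1 ≤ t ∧ t < 0 ∧ (t : ℂ) ∈ curveS (weight z zr) := by
  have hc : ContinuousOn (fun s : ℝ => diagKernel z zr (s : ℂ)) (Set.Icc (-1) 0) := by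
    refine h.continuousOn_diagKernel.comp Complex.continuous_ofReal.continuousOn fun s hs => ?_
    simp only [Metric.mem_closedBall, dist_zero_right, Complex.norm_real, Real.norm_eq_abs, abs_le]
    exact ⟨hs.1, by linarith [hs.2]⟩
  have h0 : (0 : ℝ) ∈ Set.Icc (diagKernel z zr ((0 : ℝ) : ℂ)) (diagKernel z zr ((-1 : ℝ) : ℂ)) := by
    constructor
    · simp [diagKernel_zero, h.pos.le]
    · exact h.diagKernel_nonneg_of_norm_eq_one (by simp)
  obtain ⟨t, ht, ht0⟩ := intermediate_value_Icc' (by norm_num) hc h0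
  have ht0' : diagKernel z zr (t : ℂ) = 0 := ht0
  refine ⟨t, ht.1, lt_of_le_of_ne ht.2 ?_, h.mem_curveS.2 ⟨?_, ht0'⟩⟩
  · rintro rfl
    exact h.ne_zero_of_diagKernel_nonneg ht0'.ge (by simp)
  · rw [Complex.norm_real, Real.norm_eq_abs, abs_le]
    exact ⟨ht.1, by linarith [ht.2]⟩

lemma ofReal_mem_curveS_iff (h : IsModel z zr) {t : ℝ} (ht0 : t < 0)
    (ht : (t : ℂ) ∈ curveS (weight z zr)) (s : ℝ) :
    (s : ℂ) ∈ curveS (weight z zr) ↔ s = 1 ∨ s = t := by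
  constructor
  · intro hs
    rcases lt_trichotomy s 0 with h0 | rfl | h0
    · right
      have := h.eq_of_mem_curveS_ray (c := s / t) (div_pos_of_neg_of_neg h0 ht0) ht
        (by rw [← Complex.ofReal_mul, div_mul_cancel₀ _ ht0.ne]; exact hs)
      exact (div_eq_one_iff_eq ht0.ne).1 this
    · exact absurd (h.mem_curveS.1 hs).2 (by simp [diagKernel_zero, h.pos.ne'])
    · left
      exact h.eq_of_mem_curveS_ray h0 h.one_mem_curveS (by simpa using hs)
  · rintro (rfl | rfl)
    · simpa using h.one_mem_curveS
    · exact ht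

end IsModel

/-! ### Mapping properties of `I₀` -/

/-- The power series `∑ z_r x^{r+1}` that occurs in `I₀`. -/
def stepSum (zr : ℕ → ℝ) (x : ℂ) : ℂ := ∑' r : ℕ, (zr r : ℂ) * x ^ (r + 1)

/-- The regular function `x I₀(x)`, including its value `z` at the origin. -/
def regularI0 (z : ℝ) (zr : ℕ → ℝ) (x : ℂ) : ℂ := x ^ 2 + z - x * stepSum zr x

lemma I0_eq (z : ℝ) (zr : ℕ → ℝ) (x : ℂ) : I0 z zr x = x + z / x - stepSum zr x := rfl

lemma mul_I0 (z : ℝ) (zr : ℕ → ℝ) {x : ℂ} (hx : x ≠ 0) : x * I0 z zr x = regularI0 z zr x := by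
  rw [I0_eq, regularI0]
  field_simp

lemma regularI0_zero (z : ℝ) (zr : ℕ → ℝ) : regularI0 z zr 0 = z := by simp [regularI0]

/-- A holomorphic function on a convex domain whose derivative has positive imaginary part is
injective (the Noshiro–Warschawski criterion). -/
lemma injOn_of_im_deriv_pos {f f' : ℂ → ℂ} {U : Set ℂ} (hU : Convex ℝ U)
    (hf : ∀ x ∈ U, HasDerivAt f (f' x) x) (hf' : ∀ x ∈ U, 0 < (f' x).im) : Set.InjOn f U := by
  intro x hx y hy hxy
  by_contra hne
  have hd : y - x ≠ 0 := sub_ne_zero.2 (Ne.symm hne)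
  have hmem : ∀ s ∈ Set.Icc (0 : ℝ) 1, x + (s : ℂ) * (y - x) ∈ U := fun s hs => by
    have := hU.add_smul_sub_mem hx hy hs
    rwa [Complex.real_smul] at this
  let g : ℝ → ℝ := fun s => (f (x + (s : ℂ) * (y - x)) / (y - x)).im
  have hg : ∀ s ∈ Set.Icc (0 : ℝ) 1, HasDerivAt g (f' (x + (s : ℂ) * (y - x))).im s := by
    intro s hs
    have h1 : HasDerivAt (fun s : ℂ => x + s * (y - x)) (y - x) (s : ℂ) := by
      simpa using ((hasDerivAt_id (s : ℂ)).mul_const (y - x)).const_add x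
    have h2 := ((hf _ (hmem s hs)).comp (s : ℂ) h1).div_const (y - x)
    rw [mul_div_cancel_right₀ _ hd] at h2
    exact Complex.imCLM.hasFDerivAt.comp_hasDerivAt s h2.comp_ofReal
  obtain ⟨c, hc, hc'⟩ := exists_hasDerivAt_eq_slope g (fun s => (f' (x + (s : ℂ) * (y - x))).im)
    zero_lt_one (fun s hs => (hg s hs).continuousAt.continuousWithinAt)
    (fun s hs => hg s ⟨hs.1.le, hs.2.le⟩)
  have h0 : g 1 = g 0 := by simp [g, hxy]
  rw [h0, sub_self, zero_div] at hc'
  exact (hf' _ (hmem c ⟨hc.1.le, hc.2.le⟩)).ne' hc'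

namespace IsModel

variable {z : ℝ} {zr : ℕ → ℝ} {t : ℝ}

lemma hasDerivWithinAt_stepSum (h : IsModel z zr) {x : ℂ} (hx : ‖x‖ ≤ 1) :
    HasDerivWithinAt (stepSum zr) (stepSeries zr x x) (Metric.closedBall 0 1) x := by
  rw [hasDerivWithinAt_iff_tendsto_slope]
  have hxm : x ∈ Metric.closedBall (0 : ℂ) 1 := by simpa using hx
  have h1 : ContinuousWithinAt (fun y => stepSeries zr y x) (Metric.closedBall 0 1) x :=
    (h.continuousOn_stepSeries.comp (f := fun y : ℂ => (y, x)) (s := Metric.closedBall 0 1)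
      (by fun_prop) (fun y hy => ⟨hy, hxm⟩)) x hxm
  refine (h1.mono_left (nhdsWithin_mono x Set.sdiff_subset)).congr' ?_
  filter_upwards [self_mem_nhdsWithin] with y hy
  have hyx : y - x ≠ 0 := sub_ne_zero.2 hy.2
  rw [slope_def_field, stepSum, stepSum, h.tsum_pow_succ_sub (by simpa using hy.1) hx]
  field_simp

lemma hasDerivWithinAt_I0 (h : IsModel z zr) {x : ℂ} (hx : ‖x‖ ≤ 1) (hx0 : x ≠ 0) :
    HasDerivWithinAt (I0 z zr) (1 - z / x ^ 2 - stepSeries zr x x) (Metric.closedBall 0 1) x := by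
  have h1 := (((hasDerivAt_id x).add ((hasDerivAt_inv hx0).const_mul (z : ℂ))).hasDerivWithinAt
    (s := Metric.closedBall 0 1)).sub (h.hasDerivWithinAt_stepSum hx)
  have e : I0 z zr = (id + fun y => (z : ℂ) * y⁻¹) - stepSum zr := by
    ext y; simp [I0_eq, div_eq_mul_inv]
  rw [e]
  exact h1.congr_deriv (by rw [div_eq_mul_inv]; ring)

lemma closedBall_mem_nhds {x : ℂ} (hx : ‖x‖ < 1) : Metric.closedBall (0 : ℂ) 1 ∈ 𝓝 x :=
  mem_of_superset (Metric.isOpen_ball.mem_nhds (by simpa using hx)) Metric.ball_subset_closedBall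

lemma hasDerivAt_I0 (h : IsModel z zr) {x : ℂ} (hx : ‖x‖ < 1) (hx0 : x ≠ 0) :
    HasDerivAt (I0 z zr) (1 - z / x ^ 2 - stepSeries zr x x) x :=
  (h.hasDerivWithinAt_I0 hx.le hx0).hasDerivAt (closedBall_mem_nhds hx)

lemma hasDerivAt_stepSum (h : IsModel z zr) {x : ℂ} (hx : ‖x‖ < 1) :
    HasDerivAt (stepSum zr) (stepSeries zr x x) x :=
  (h.hasDerivWithinAt_stepSum hx.le).hasDerivAt (closedBall_mem_nhds hx)

lemma analyticAt_I0 (h : IsModel z zr) {x : ℂ} (hx : ‖x‖ < 1) (hx0 : x ≠ 0) :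
    AnalyticAt ℂ (I0 z zr) x := by
  have hd : DifferentiableOn ℂ (I0 z zr) (Metric.ball 0 1 ∩ {0}ᶜ) := fun y hy =>
    (h.hasDerivAt_I0 (by simpa using hy.1) hy.2).differentiableAt.differentiableWithinAt
  exact hd.analyticAt ((Metric.isOpen_ball.inter isOpen_compl_singleton).mem_nhds
    ⟨by simpa using hx, hx0⟩)

lemma continuousOn_regularI0 (h : IsModel z zr) :
    ContinuousOn (regularI0 z zr) (Metric.closedBall 0 1) := by
  have h1 : ContinuousOn (stepSum zr) (Metric.closedBall 0 1) := fun x hx =>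
    (h.hasDerivWithinAt_stepSum (by simpa using hx)).continuousWithinAt
  unfold regularI0
  fun_prop

lemma hasDerivAt_regularI0 (h : IsModel z zr) {x : ℂ} (hx : ‖x‖ < 1) :
    HasDerivAt (regularI0 z zr) (2 * x - (stepSum zr x + x * stepSeries zr x x)) x := by
  have := (((hasDerivAt_id x).pow 2).add_const (z : ℂ)).sub
    ((hasDerivAt_id x).mul (h.hasDerivAt_stepSum hx))
  have e : regularI0 z zr = (fun y => (id ^ 2) y + (z : ℂ)) - id * stepSum zr := by
    ext y; simp [regularI0]
  rw [e]
  exact this.congr_deriv (by simp)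

lemma stepSeries_diag (h : IsModel z zr) {x : ℂ} (hx : ‖x‖ ≤ 1) :
    HasSum (fun r : ℕ => ((r : ℂ) + 1) * zr r * x ^ r) (stepSeries zr x x) := by
  have h1 := hasSum_antidiagonal_sum (h.summable_norm_term hx hx).of_norm
  refine (congrArg (HasSum · _) (funext fun r => ?_)).mp h1
  have h2 : ∀ m ∈ Finset.HasAntidiagonal.antidiagonal r,
      (zr (m.1 + m.2) : ℂ) * x ^ m.1 * x ^ m.2 = zr r * x ^ r := fun m hm => by
    rw [mul_assoc, ← pow_add, Finset.HasAntidiagonal.mem_antidiagonal.1 hm]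
  rw [Finset.sum_congr rfl h2]
  simp
  ring

/-- In the coordinate `log x`, the derivative of `I₀` has positive imaginary part on the upper half
of the unit disc. The bound uses the second moment `∑ (r+1)² z_r = 1 + z`. -/
lemma im_mul_deriv_I0_pos (h : IsModel z zr) {x : ℂ} (hx : ‖x‖ < 1) (him : 0 < x.im) :
    0 < (x * (1 - z / x ^ 2 - stepSeries zr x x)).im := by
  have hx0 : x ≠ 0 := by rintro rfl; simp at him
  have hn : 0 < ‖x‖ ^ 2 := by positivity
  have h1 : x * (1 - z / x ^ 2 - stepSeries zr x x) = x - z / x - x * stepSeries zr x x := by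
    field_simp
  have h2 : ((z : ℂ) / x).im = - (z * x.im / ‖x‖ ^ 2) := by
    rw [Complex.div_im, Complex.normSq_eq_norm_sq]
    simp
  have h3 : (x * stepSeries zr x x).im ≤ (1 + z) * x.im := by
    have e := Complex.hasSum_im ((h.stepSeries_diag hx.le).mul_left x)
    refine hasSum_le (fun r => ?_) e (h.hasSum_sq.mul_right x.im)
    have e1 : x * (((r : ℂ) + 1) * zr r * x ^ r) = (((r + 1) * zr r : ℝ) : ℂ) * x ^ (r + 1) := by
      push_cast; ring
    rw [e1, Complex.im_ofReal_mul]
    have e2 := (le_abs_self _).trans (abs_im_pow_le hx.le (r + 1))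
    rw [abs_of_pos him] at e2
    push_cast at e2
    calc _ ≤ ((r : ℝ) + 1) * zr r * (((r : ℝ) + 1) * x.im) :=
          mul_le_mul_of_nonneg_left e2 (mul_nonneg (by positivity) (h.nonneg r))
      _ = _ := by ring
  rw [h1, Complex.sub_im, Complex.sub_im, h2]
  have h4 : z * x.im < z * x.im / ‖x‖ ^ 2 := by
    rw [lt_div_iff₀ hn]
    exact mul_lt_of_lt_one_right (mul_pos h.pos him) (pow_lt_one₀ (norm_nonneg _) hx two_ne_zero)
  linarith

lemma injOn_I0_upper (h : IsModel z zr) :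
    Set.InjOn (I0 z zr) {x : ℂ | ‖x‖ < 1 ∧ 0 < x.im} := by
  have hS : Convex ℝ {w : ℂ | w.re < 0 ∧ 0 < w.im ∧ w.im < Real.pi} :=
    (convex_halfSpace_re_lt 0).inter
      ((convex_halfSpace_im_gt 0).inter (convex_halfSpace_im_lt Real.pi))
  have hexp : ∀ w ∈ {w : ℂ | w.re < 0 ∧ 0 < w.im ∧ w.im < Real.pi},
      ‖Complex.exp w‖ < 1 ∧ 0 < (Complex.exp w).im := by
    rintro w ⟨h1, h2, h3⟩
    rw [Complex.norm_exp, Complex.exp_im]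
    exact ⟨Real.exp_lt_one_iff.2 h1, mul_pos (Real.exp_pos _) (Real.sin_pos_of_pos_of_lt_pi h2 h3)⟩
  have key := injOn_of_im_deriv_pos hS (f := fun w => I0 z zr (Complex.exp w))
    (f' := fun w => Complex.exp w * (1 - z / Complex.exp w ^ 2 -
      stepSeries zr (Complex.exp w) (Complex.exp w)))
    (fun w hw => by
      have := (h.hasDerivAt_I0 (hexp w hw).1 (Complex.exp_ne_zero w)).comp w
        (Complex.hasDerivAt_exp w)
      rwa [mul_comm] at this)
    (fun w hw => h.im_mul_deriv_I0_pos (hexp w hw).1 (hexp w hw).2)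
  have hlog : ∀ x ∈ {x : ℂ | ‖x‖ < 1 ∧ 0 < x.im}, x ≠ 0 ∧
      Complex.log x ∈ {w : ℂ | w.re < 0 ∧ 0 < w.im ∧ w.im < Real.pi} := by
    rintro x ⟨h1, h2⟩
    have hx0 : x ≠ 0 := by rintro rfl; simp at h2
    refine ⟨hx0, ?_, ?_, ?_⟩
    · rw [Complex.log_re]; exact Real.log_neg (norm_pos_iff.2 hx0) h1
    · rw [Complex.log_im]
      exact lt_of_le_of_ne (Complex.arg_nonneg_iff.2 h2.le)
        fun h3 => h2.ne' (Complex.arg_eq_zero_iff.1 h3.symm).2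
    · rw [Complex.log_im]
      exact lt_of_le_of_ne (Complex.arg_le_pi x)
        fun h3 => h2.ne' (Complex.arg_eq_pi_iff.1 h3).2
  intro x hx y hy hxy
  obtain ⟨hx0, hxl⟩ := hlog x hx
  obtain ⟨hy0, hyl⟩ := hlog y hy
  have := key hxl hyl (by simpa [Complex.exp_log hx0, Complex.exp_log hy0] using hxy)
  rw [← Complex.exp_log hx0, this, Complex.exp_log hy0]

lemma ne_zero_of_im_pos {x : ℂ} (hx : 0 < x.im) : x ≠ 0 := by
  rintro rfl; simp at hx

/-- The image of the upper half of the interior of the curve is the lower half-plane: it is open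
there because `I₀' ≠ 0`, and closed there because `I₀` is real on the rest of the boundary. -/
lemma exists_I0_eq_of_im_neg (h : IsModel z zr) {w : ℂ} (hw : w.im < 0) :
    ∃ x ∈ starDomain z zr, 0 < x.im ∧ I0 z zr x = w := by
  set U : Set ℂ := starDomain z zr ∩ {x | 0 < x.im} with hU
  have hUo : IsOpen U := h.isOpen_starDomain.inter
    (isOpen_lt continuous_const Complex.continuous_im)
  have himg : ∀ x ∈ U, (I0 z zr x).im < 0 := fun x hx => by
    rw [h.I0_im hx.1.1 (ne_zero_of_im_pos hx.2)]
    exact mul_neg_of_pos_of_neg hx.2 ((mem_starDomain_iff (ne_zero_of_im_pos hx.2)).1 hx.1).2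
  have hopen : IsOpen (I0 z zr '' U) := by
    rw [isOpen_iff_mem_nhds]
    rintro _ ⟨x, hx, rfl⟩
    have hx1 := h.norm_lt_one_of_mem hx.1
    have hx0 := ne_zero_of_im_pos hx.2
    have hs := (h.analyticAt_I0 hx1 hx0).hasStrictDerivAt
    rw [(h.hasDerivAt_I0 hx1 hx0).deriv] at hs
    rw [← hs.map_nhds_eq]
    · exact image_mem_map (hUo.mem_nhds hx)
    · intro h0
      have := h.im_mul_deriv_I0_pos hx1 hx.2
      simp [h0] at this
  have hpre : IsPreconnected {w : ℂ | w.im < 0} := (convex_halfSpace_im_lt 0).isPreconnected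
  have hne : ({w : ℂ | w.im < 0} ∩ I0 z zr '' U).Nonempty := by
    obtain ⟨ε, hε, hb⟩ := Metric.isOpen_iff.1 h.isOpen_starDomain 0 h.zero_mem_starDomain
    have hx : ((ε / 2 : ℝ) : ℂ) * Complex.I ∈ U := by
      refine ⟨hb ?_, ?_⟩
      · simp [abs_of_pos hε, hε]
      · simp [hε]
    exact ⟨_, himg _ hx, _, hx, rfl⟩
  have hsub := hpre.subset_of_closure_inter_subset hopen hne (by
    rintro w ⟨hwc, hwi⟩
    have hwi : w.im < 0 := hwi
    obtain ⟨u, hu, hlim⟩ := mem_closure_iff_seq_limit.1 hwc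
    choose x hx hxu using hu
    obtain ⟨y, hy, φ, hφ, hyl⟩ := (isCompact_closedBall (0 : ℂ) 1).tendsto_subseq
      (fun n => show x n ∈ Metric.closedBall (0 : ℂ) 1 by simpa using (hx n).1.1)
    have hy1 : ‖y‖ ≤ 1 := by simpa using hy
    have hreg : Tendsto (fun n => regularI0 z zr (x (φ n))) atTop (𝓝 (regularI0 z zr y)) :=
      (h.continuousOn_regularI0 y hy).tendsto.comp
        (tendsto_nhdsWithin_iff.2 ⟨hyl, Eventually.of_forall fun n => by
          simpa using (hx (φ n)).1.1⟩)
    have hreg2 : Tendsto (fun n => regularI0 z zr (x (φ n))) atTop (𝓝 (y * w)) := by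
      refine (hyl.mul (hlim.comp hφ.tendsto_atTop)).congr fun n => ?_
      simp only [Function.comp]
      rw [← hxu, mul_I0 z zr (ne_zero_of_im_pos (hx (φ n)).2)]
    have heq := tendsto_nhds_unique hreg hreg2
    have hy0 : y ≠ 0 := by
      rintro rfl
      rw [regularI0_zero, zero_mul] at heq
      exact h.pos.ne' (by exact_mod_cast heq)
    rw [← mul_I0 z zr hy0] at heq
    have hyw := mul_left_cancel₀ hy0 heq
    have hyim : 0 ≤ y.im := ge_of_tendsto ((Complex.continuous_im.tendsto y).comp hyl)
      (Eventually.of_forall fun n => (hx (φ n)).2.le)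
    have hprod := h.I0_im hy1 hy0
    rw [hyw] at hprod
    rw [hprod] at hwi
    have hrad : radialKernel z zr y < 0 := by
      by_contra hcon
      exact absurd hwi (not_lt.2 (mul_nonneg hyim (not_lt.1 hcon)))
    have hyim' : 0 < y.im := by
      rcases hyim.eq_or_lt with h0 | h0
      · rw [← h0, zero_mul] at hwi
        exact absurd hwi (lt_irrefl _)
      · exact h0
    exact ⟨y, ⟨(mem_starDomain_iff hy0).2 ⟨hy1, hrad⟩, hyim'⟩, hyw⟩)
  obtain ⟨x, hx, hxw⟩ := hsub hw
  exact ⟨x, hx.1, hx.2, hxw⟩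

/-! ### Real values of `I₀` -/

lemma deriv_eq_radialKernel (s : ℝ) :
    (1 : ℂ) - z / (s : ℂ) ^ 2 - stepSeries zr s s = radialKernel z zr s := by
  have h1 := stepSeries_conj_im zr s
  rw [Complex.conj_ofReal] at h1
  have h2 : ‖(s : ℂ)‖ ^ 2 = s ^ 2 := by simp
  rw [radialKernel, h2, Complex.conj_ofReal]
  apply Complex.ext <;> simp [← Complex.ofReal_pow, ← Complex.ofReal_div, h1]

lemma norm_ofReal_le_one {s : ℝ} (h1 : -1 ≤ s) (h2 : s ≤ 1) : ‖(s : ℂ)‖ ≤ 1 := by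
  rw [Complex.norm_real, Real.norm_eq_abs, abs_le]
  exact ⟨h1, h2⟩

lemma norm_ofReal_lt_one {s : ℝ} (h1 : -1 < s) (h2 : s < 1) : ‖(s : ℂ)‖ < 1 := by
  rw [Complex.norm_real, Real.norm_eq_abs, abs_lt]
  exact ⟨h1, h2⟩

lemma neg_one_le (h : IsModel z zr) (ht : (t : ℂ) ∈ curveS (weight z zr)) : -1 ≤ t := by
  have := (h.mem_curveS.1 ht).1
  rw [Complex.norm_real, Real.norm_eq_abs, abs_le] at this
  exact this.1

lemma radialKernel_eq_zero (h : IsModel z zr) {x : ℂ} (hx : x ∈ curveS (weight z zr)) :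
    radialKernel z zr x = 0 := by
  have h2 := (h.mem_curveS.1 hx).2
  have hx0 := h.ne_zero_of_diagKernel_nonneg h2.ge
  rwa [diagKernel_eq z zr hx0, mul_eq_zero,
    or_iff_right (pow_ne_zero _ (norm_ne_zero_iff.2 hx0))] at h2

lemma radialKernel_neg_of_pos (h : IsModel z zr) {s : ℝ} (h0 : 0 < s) (h1 : s < 1) :
    radialKernel z zr s < 0 := by
  have := h.radialKernel_smul_lt (x := 1) (by simp) one_ne_zero h0 h1
  rwa [h.radialKernel_one, mul_one] at this

lemma radialKernel_neg_of_neg (h : IsModel z zr) (ht : (t : ℂ) ∈ curveS (weight z zr)) {s : ℝ}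
    (h0 : t < s) (h1 : s < 0) : radialKernel z zr s < 0 := by
  have ht0 : t < 0 := h0.trans h1
  have := h.radialKernel_smul_lt (c := s / t) (h.mem_curveS.1 ht).1
    (by exact_mod_cast ht0.ne) (div_pos_of_neg_of_neg h1 ht0) ((div_lt_one_of_neg ht0).2 h0)
  rwa [h.radialKernel_eq_zero ht, ← Complex.ofReal_mul, div_mul_cancel₀ _ ht0.ne] at this

lemma hasDerivAt_re_I0 (h : IsModel z zr) {s : ℝ} (h1 : -1 < s) (h2 : s < 1) (h0 : s ≠ 0) :
    HasDerivAt (fun s : ℝ => (I0 z zr s).re) (radialKernel z zr s) s := by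
  have h3 := h.hasDerivAt_I0 (norm_ofReal_lt_one h1 h2) (by exact_mod_cast h0)
  rw [deriv_eq_radialKernel] at h3
  exact HasDerivAt.real_of_complex h3

lemma continuousOn_re_I0 (h : IsModel z zr) :
    ContinuousOn (fun s : ℝ => (I0 z zr s).re) (Set.Icc (-1) 1 ∩ {0}ᶜ) := by
  refine Complex.continuous_re.comp_continuousOn ?_
  have h1 : ContinuousOn (I0 z zr) (Metric.closedBall 0 1 ∩ {0}ᶜ) := fun x hx =>
    ((h.hasDerivWithinAt_I0 (by simpa using hx.1) hx.2).continuousWithinAt).mono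
      Set.inter_subset_left
  refine h1.comp Complex.continuous_ofReal.continuousOn fun s hs => ⟨?_, ?_⟩
  · simpa using norm_ofReal_le_one hs.1.1 hs.1.2
  · simpa using hs.2

lemma strictAntiOn_re_I0_pos (h : IsModel z zr) :
    StrictAntiOn (fun s : ℝ => (I0 z zr s).re) (Set.Ioc 0 1) := by
  refine strictAntiOn_of_deriv_neg (convex_Ioc 0 1) (h.continuousOn_re_I0.mono fun s hs =>
    ⟨⟨by linarith [hs.1], hs.2⟩, hs.1.ne'⟩) fun s hs => ?_
  rw [interior_Ioc] at hs
  rw [(h.hasDerivAt_re_I0 (by linarith [hs.1]) hs.2 hs.1.ne').deriv]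
  exact h.radialKernel_neg_of_pos hs.1 hs.2

lemma strictAntiOn_re_I0_neg (h : IsModel z zr) (ht : (t : ℂ) ∈ curveS (weight z zr)) :
    StrictAntiOn (fun s : ℝ => (I0 z zr s).re) (Set.Ico t 0) := by
  have ht1 := h.neg_one_le ht
  refine strictAntiOn_of_deriv_neg (convex_Ico t 0) (h.continuousOn_re_I0.mono fun s hs =>
    ⟨⟨by linarith [hs.1], by linarith [hs.2]⟩, hs.2.ne⟩) fun s hs => ?_
  rw [interior_Ico] at hs
  rw [(h.hasDerivAt_re_I0 (by linarith [hs.1]) (by linarith [hs.2]) hs.2.ne).deriv]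
  exact h.radialKernel_neg_of_neg ht hs.1 hs.2

lemma I0_lt_I0_one (h : IsModel z zr) (ht0 : t < 0) (ht : (t : ℂ) ∈ curveS (weight z zr)) :
    (I0 z zr t).re < (I0 z zr 1).re := by
  have ht1 : ‖(t : ℂ)‖ ≤ 1 := (h.mem_curveS.1 ht).1
  have h1 := h.I0_sub (x := 1) (y := t) (by simp) ht1 one_ne_zero (by exact_mod_cast ht0.ne)
  have h2 := (Complex.re_le_norm _).trans (h.norm_stepSeries_le (x := 1) (by simp) ht1)
  have h3 := congrArg Complex.re h1
  rw [show (1 - (t : ℂ)) = ((1 - t : ℝ) : ℂ) by push_cast; ring, Complex.re_ofReal_mul, one_mul,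
    ← Complex.ofReal_div, Complex.sub_re, Complex.sub_re, Complex.sub_re, Complex.one_re,
    Complex.ofReal_re] at h3
  have h4 : z / t < 0 := div_neg_of_pos_of_neg h.pos ht0
  have h5 : 0 < (1 - t) * (1 - z / t - (stepSeries zr 1 t).re) :=
    mul_pos (by linarith) (by linarith [h.pos])
  linarith

lemma ofReal_mem_starDomain_iff (h : IsModel z zr) (ht0 : t < 0)
    (ht : (t : ℂ) ∈ curveS (weight z zr)) (s : ℝ) :
    (s : ℂ) ∈ starDomain z zr ↔ t < s ∧ s < 1 := by
  constructor
  · intro hs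
    have h1 := h.norm_lt_one_of_mem hs
    rw [Complex.norm_real, Real.norm_eq_abs, abs_lt] at h1
    refine ⟨?_, h1.2⟩
    by_contra hst
    have hst : s ≤ t := not_lt.1 hst
    have hs0 : s < 0 := hst.trans_lt ht0
    have h2 := h.smul_mem_starDomain hs (c := t / s) (div_nonneg_of_nonpos ht0.le hs0.le)
      ((div_le_one_of_neg hs0).2 hst)
    rw [← Complex.ofReal_mul, div_mul_cancel₀ _ hs0.ne] at h2
    exact h2.2.ne (h.mem_curveS.1 ht).2
  · rintro ⟨h1, h2⟩
    have ht1 := h.neg_one_le ht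
    rcases lt_trichotomy s 0 with h0 | rfl | h0
    · exact (mem_starDomain_iff (by exact_mod_cast h0.ne)).2
        ⟨norm_ofReal_le_one (by linarith) (by linarith), h.radialKernel_neg_of_neg ht h1 h0⟩
    · simpa using h.zero_mem_starDomain
    · exact (mem_starDomain_iff (by exact_mod_cast h0.ne')).2
        ⟨norm_ofReal_le_one (by linarith) (by linarith), h.radialKernel_neg_of_pos h0 h2⟩

lemma abs_re_I0_sub_le (h : IsModel z zr) {s : ℝ} (h1 : -1 ≤ s) (h2 : s ≤ 1) :
    |(I0 z zr s).re - z / s| ≤ 2 := by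
  have hs := norm_ofReal_le_one h1 h2
  have h3 : ‖stepSum zr s‖ ≤ 1 - z := by
    refine tsum_of_norm_bounded h.mass fun r => ?_
    rw [norm_mul, norm_pow, Complex.norm_real, Real.norm_of_nonneg (h.nonneg _)]
    have h1 : ‖(s : ℂ)‖ ^ (r + 1) ≤ 1 := pow_le_one₀ (norm_nonneg _) hs
    nlinarith [h.nonneg r, mul_nonneg (Nat.cast_nonneg (α := ℝ) r) (h.nonneg r)]
  have h4 : (I0 z zr s).re - z / s = s - (stepSum zr s).re := by
    rw [I0_eq, ← Complex.ofReal_div]; simp; ring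
  have h5 := (Complex.abs_re_le_norm _).trans h3
  rw [h4]
  rw [abs_le] at h5 ⊢
  constructor <;> linarith [h.pos]

lemma exists_I0_eq_of_gt (h : IsModel z zr) {w : ℝ} (hw : (I0 z zr 1).re < w) :
    ∃ s : ℝ, 0 < s ∧ s < 1 ∧ I0 z zr s = w := by
  -- near the origin `I₀(s)` differs from `z / s` by at most `2`
  obtain ⟨s, hs⟩ : ∃ s, s = z / (|w| + 3) := ⟨_, rfl⟩
  have hp : 0 < |w| + 3 := by positivity
  have hs0 : 0 < s := hs ▸ div_pos h.pos hp
  have hs1 : s < 1 := by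
    rw [hs, div_lt_one hp]; linarith [h.le_one, abs_nonneg w]
  have h1 := (abs_le.1 (h.abs_re_I0_sub_le (by linarith) hs1.le)).1
  have h2 : z / s = |w| + 3 := by
    rw [hs, div_div_cancel₀ h.pos.ne']
  have h3 : w ≤ (I0 z zr s).re := by linarith [le_abs_self w]
  obtain ⟨u, hu, huw⟩ := intermediate_value_Icc' hs1.le
    (h.continuousOn_re_I0.mono fun u hu => ⟨⟨by linarith [hu.1], hu.2⟩, by
      have : 0 < u := hs0.trans_le hu.1
      exact this.ne'⟩) (show w ∈ Set.Icc (I0 z zr ((1 : ℝ) : ℂ)).re (I0 z zr s).re from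
        ⟨by simpa using hw.le, h3⟩)
  refine ⟨u, hs0.trans_le hu.1, lt_of_le_of_ne hu.2 ?_, ?_⟩
  · rintro rfl
    simp at huw
    exact hw.ne huw
  · rw [← ofReal_re_I0, ← huw]

lemma exists_I0_eq_of_lt (h : IsModel z zr) (ht0 : t < 0) (ht : (t : ℂ) ∈ curveS (weight z zr))
    {w : ℝ} (hw : w < (I0 z zr t).re) : ∃ s : ℝ, t < s ∧ s < 0 ∧ I0 z zr s = w := by
  have ht1 := h.neg_one_le ht
  obtain ⟨s, hs⟩ : ∃ s, s = max t (-(z / (|w| + 3))) := ⟨_, rfl⟩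
  have hp : 0 < |w| + 3 := by positivity
  have hs0 : s < 0 := by
    rw [hs]; exact max_lt ht0 (neg_neg_of_pos (div_pos h.pos hp))
  have hst : t ≤ s := hs ▸ le_max_left _ _
  have h1 := (abs_le.1 (h.abs_re_I0_sub_le (hst.trans' ht1) (by linarith))).2
  have h2 : z / s ≤ -(|w| + 3) := by
    have : -(z / (|w| + 3)) ≤ s := hs ▸ le_max_right _ _
    rw [div_le_iff_of_neg hs0]
    have h3 := mul_le_mul_of_nonneg_left this hp.le
    rw [mul_neg, mul_div_cancel₀ _ hp.ne'] at h3
    linarith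
  have h3 : (I0 z zr s).re ≤ w := by linarith [neg_abs_le w]
  obtain ⟨u, hu, huw⟩ := intermediate_value_Icc' hst
    (h.continuousOn_re_I0.mono fun u hu => ⟨⟨by linarith [hu.1], by linarith [hu.2]⟩, by
      have : u < 0 := hu.2.trans_lt hs0
      exact this.ne⟩) (show w ∈ Set.Icc (I0 z zr s).re (I0 z zr t).re from ⟨h3, hw.le⟩)
  refine ⟨u, lt_of_le_of_ne hu.1 ?_, hu.2.trans_lt hs0, ?_⟩
  · rintro rfl
    exact hw.ne' huw
  · rw [← ofReal_re_I0, ← huw]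

/-- In the interior of the curve `I₀` takes no value in the segment `[I₀(t), I₀(1)]`. -/
lemma I0_notMem_segment (h : IsModel z zr) (ht0 : t < 0) (ht : (t : ℂ) ∈ curveS (weight z zr))
    {x : ℂ} (hx : x ∈ starDomain z zr) (hx0 : x ≠ 0) :
    (I0 z zr x).im ≠ 0 ∨ (I0 z zr x).re < (I0 z zr t).re ∨ (I0 z zr 1).re < (I0 z zr x).re := by
  by_cases him : x.im = 0
  · right
    obtain ⟨s, rfl⟩ : ∃ s : ℝ, x = s := ⟨x.re, Complex.ext rfl (by simp [him])⟩
    obtain ⟨h1, h2⟩ := (h.ofReal_mem_starDomain_iff ht0 ht s).1 hx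
    rcases lt_or_gt_of_ne (show s ≠ 0 by exact_mod_cast hx0) with h0 | h0
    · left
      exact h.strictAntiOn_re_I0_neg ht ⟨le_rfl, ht0⟩ ⟨h1.le, h0⟩ h1
    · right
      have := h.strictAntiOn_re_I0_pos ⟨h0, h2.le⟩ (Set.right_mem_Ioc.2 one_pos) h2
      simpa using this
  · left
    rw [h.I0_im hx.1 hx0]
    exact mul_ne_zero him ((mem_starDomain_iff hx0).1 hx).2.ne

/-- In the interior of the curve `I₀` takes every value off the segment `[I₀(t), I₀(1)]`. -/
lemma exists_I0_eq (h : IsModel z zr) (ht0 : t < 0) (ht : (t : ℂ) ∈ curveS (weight z zr))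
    {w : ℂ} (hw : w.im ≠ 0 ∨ w.re < (I0 z zr t).re ∨ (I0 z zr 1).re < w.re) :
    ∃ x ∈ starDomain z zr, x ≠ 0 ∧ I0 z zr x = w := by
  rcases lt_trichotomy w.im 0 with him | him | him
  · obtain ⟨x, hx, hxi, hxw⟩ := h.exists_I0_eq_of_im_neg him
    exact ⟨x, hx, ne_zero_of_im_pos hxi, hxw⟩
  · obtain ⟨w, rfl⟩ : ∃ s : ℝ, w = s := ⟨w.re, Complex.ext rfl (by simp [him])⟩
    rcases hw with hw | hw | hw
    · exact absurd him hw
    · obtain ⟨s, h1, h2, h3⟩ := h.exists_I0_eq_of_lt ht0 ht hw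
      exact ⟨s, (h.ofReal_mem_starDomain_iff ht0 ht s).2 ⟨h1, by linarith⟩,
        by exact_mod_cast h2.ne, h3⟩
    · obtain ⟨s, h1, h2, h3⟩ := h.exists_I0_eq_of_gt hw
      exact ⟨s, (h.ofReal_mem_starDomain_iff ht0 ht s).2 ⟨by linarith, h2⟩,
        by exact_mod_cast h1.ne', h3⟩
  · obtain ⟨x, hx, hxi, hxw⟩ := h.exists_I0_eq_of_im_neg (w := starRingEnd ℂ w) (by simpa using him)
    have hx0 : starRingEnd ℂ x ≠ 0 := by simpa using ne_zero_of_im_pos hxi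
    refine ⟨starRingEnd ℂ x, ?_, hx0, ?_⟩
    · refine ⟨by simpa using hx.1, ?_⟩
      have := hx.2
      rw [diagKernel] at this ⊢
      rwa [Complex.conj_conj, RCLike.norm_conj, stepSeries_comm]
    · rw [I0_conj, hxw, Complex.conj_conj]

lemma injOn_I0 (h : IsModel z zr) (ht0 : t < 0) (ht : (t : ℂ) ∈ curveS (weight z zr)) :
    Set.InjOn (I0 z zr) (starDomain z zr \ {0}) := by
  rintro x ⟨hx, hx0⟩ y ⟨hy, hy0⟩ hxy
  have hx1 := h.norm_lt_one_of_mem hx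
  have hy1 := h.norm_lt_one_of_mem hy
  have ex := h.I0_im hx.1 hx0
  have ey := h.I0_im hy.1 hy0
  have rx := ((mem_starDomain_iff hx0).1 hx).2
  have ry := ((mem_starDomain_iff hy0).1 hy).2
  rw [hxy, ey] at ex
  rcases lt_trichotomy x.im 0 with him | him | him
  · have hyi : y.im < 0 := by
      have := mul_pos_of_neg_of_neg him rx
      rw [← ex] at this
      exact neg_of_mul_pos_left this ry.le
    have := h.injOn_I0_upper (x₁ := starRingEnd ℂ x) (x₂ := starRingEnd ℂ y)
      ⟨by simpa using hx1, by simpa using him⟩ ⟨by simpa using hy1, by simpa using hyi⟩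
      (by rw [I0_conj, I0_conj, hxy])
    exact (starRingEnd ℂ).injective this
  · have hyi : y.im = 0 := by
      rw [him, zero_mul] at ex
      exact (mul_eq_zero.1 ex).resolve_right ry.ne
    obtain ⟨s, rfl⟩ : ∃ s : ℝ, x = s := ⟨x.re, Complex.ext rfl (by simp [him])⟩
    obtain ⟨u, rfl⟩ : ∃ s : ℝ, y = s := ⟨y.re, Complex.ext rfl (by simp [hyi])⟩
    have hs := (h.ofReal_mem_starDomain_iff ht0 ht s).1 hx
    have hu := (h.ofReal_mem_starDomain_iff ht0 ht u).1 hy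
    have hre : (I0 z zr s).re = (I0 z zr u).re := by rw [hxy]
    have neg_lt : ∀ s : ℝ, t < s → s < 0 → (I0 z zr s).re < (I0 z zr t).re := fun s h1 h2 =>
      h.strictAntiOn_re_I0_neg ht ⟨le_rfl, ht0⟩ ⟨h1.le, h2⟩ h1
    have lt_pos : ∀ s : ℝ, 0 < s → s < 1 → (I0 z zr 1).re < (I0 z zr s).re := fun s h1 h2 => by
      simpa using h.strictAntiOn_re_I0_pos ⟨h1, h2.le⟩ (Set.right_mem_Ioc.2 one_pos) h2
    have hab := h.I0_lt_I0_one ht0 ht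
    congr 1
    rcases lt_or_gt_of_ne (show s ≠ 0 by simpa using hx0) with h0 | h0 <;>
      rcases lt_or_gt_of_ne (show u ≠ 0 by simpa using hy0) with h0' | h0'
    · exact (h.strictAntiOn_re_I0_neg ht).injOn ⟨hs.1.le, h0⟩ ⟨hu.1.le, h0'⟩ hre
    · linarith [neg_lt s hs.1 h0, lt_pos u h0' hu.2]
    · linarith [neg_lt u hu.1 h0', lt_pos s h0 hs.2]
    · exact h.strictAntiOn_re_I0_pos.injOn ⟨h0, hs.2.le⟩ ⟨h0', hu.2.le⟩ hre
  · have hyi : 0 < y.im := by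
      have := mul_neg_of_pos_of_neg him rx
      rw [← ex] at this
      by_contra hcon
      exact absurd this (not_lt.2 (mul_nonneg_of_nonpos_of_nonpos (not_lt.1 hcon) ry.le))
    exact h.injOn_I0_upper ⟨hx1, him⟩ ⟨hy1, hyi⟩ hxy

/-- Among the real points of `[-1, 1)` only `t` is a critical point of `I₀`. -/
lemma hasDerivWithinAt_zero_iff (h : IsModel z zr) (ht0 : t < 0)
    (ht : (t : ℂ) ∈ curveS (weight z zr)) {s : ℝ} (h1 : -1 ≤ s) (h2 : s < 1) :
    HasDerivWithinAt (I0 z zr) 0 (Metric.closedBall 0 1) (s : ℂ) ↔ s = t := by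
  have hs := norm_ofReal_le_one h1 h2.le
  have hsm : (s : ℂ) ∈ Metric.closedBall (0 : ℂ) 1 := by simpa using hs
  rcases eq_or_ne s 0 with rfl | hs0
  · refine iff_of_false (fun hd => ?_) ht0.ne'
    -- `x I₀(x)` tends to `z ≠ 0` at the origin, so `I₀` is not even continuous there
    have hc : Tendsto (fun x => x * I0 z zr x) (𝓝[≠] 0) (𝓝 0) := by
      have e1 := hd.continuousWithinAt.tendsto
      rw [Complex.ofReal_zero, nhdsWithin_eq_nhds.2 (closedBall_mem_nhds (by simp))] at e1
      simpa using ((continuous_id.tendsto (0 : ℂ)).mul e1).mono_left nhdsWithin_le_nhds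
    have hc2 : Tendsto (regularI0 z zr) (𝓝[≠] 0) (𝓝 z) := by
      have e1 := (h.hasDerivAt_regularI0 (x := 0) (by simp)).continuousAt.tendsto
      rw [regularI0_zero] at e1
      exact e1.mono_left nhdsWithin_le_nhds
    have hc3 := tendsto_nhds_unique (hc.congr' (by
      filter_upwards [self_mem_nhdsWithin] with x hx using mul_I0 z zr hx)) hc2
    exact h.pos.ne (by exact_mod_cast hc3)
  have hs0' : (s : ℂ) ≠ 0 := by exact_mod_cast hs0
  have hd := h.hasDerivWithinAt_I0 hs hs0'
  rw [deriv_eq_radialKernel] at hd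
  have huniq : UniqueDiffWithinAt ℂ (Metric.closedBall (0 : ℂ) 1) (s : ℂ) :=
    ((uniqueDiffOn_convex (convex_closedBall (0 : ℂ) 1)
      ⟨0, by simp [interior_closedBall (0 : ℂ) one_ne_zero]⟩) _ hsm).mono_field
  have h3 : HasDerivWithinAt (I0 z zr) 0 (Metric.closedBall 0 1) (s : ℂ) ↔
      radialKernel z zr s = 0 := by
    constructor
    · intro hd'
      exact_mod_cast huniq.eq_deriv _ hd hd'
    · intro h0
      rw [h0] at hd
      simpa using hd
  have h4 := h.ofReal_mem_curveS_iff ht0 ht s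
  rw [or_iff_right h2.ne] at h4
  rw [h3, ← h4, h.mem_curveS, diagKernel_eq z zr hs0', mul_eq_zero,
    or_iff_right (pow_ne_zero _ (norm_ne_zero_iff.2 hs0')), and_iff_right hs]

end IsModel

/-! ### The map `ρ` -/

/-- The quotient `(I₀(x) - I₀(t)) / (I₀(x) - I₀(1))` with the pole of `I₀` at the origin
removed. -/
def ratioExt (z : ℝ) (zr : ℕ → ℝ) (t : ℝ) (x : ℂ) : ℂ :=
  (regularI0 z zr x - I0 z zr t * x) / (regularI0 z zr x - I0 z zr 1 * x)

lemma ratioExt_eq (z : ℝ) (zr : ℕ → ℝ) (t : ℝ) {x : ℂ} (hx : x ≠ 0) :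
    ratioExt z zr t x = ratio z zr t x := by
  rw [ratioExt, ratio, ← mul_I0 z zr hx, mul_comm x, ← sub_mul, ← sub_mul, mul_div_mul_right _ _ hx]

lemma ratio_mem_slitPlane {a b : ℝ} (hab : a < b) {w : ℂ} (hw : w.im ≠ 0 ∨ w.re < a ∨ b < w.re) :
    w - b ≠ 0 ∧ (w - a) / (w - b) ∈ Complex.slitPlane := by
  have h0 : w - b ≠ 0 := by
    intro h0
    rw [sub_eq_zero.1 h0] at hw
    simp only [Complex.ofReal_im, Complex.ofReal_re] at hw
    rcases hw with hw | hw | hw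
    · exact hw rfl
    · linarith
    · linarith
  refine ⟨h0, ?_⟩
  by_cases him : w.im = 0
  · obtain ⟨u, rfl⟩ : ∃ s : ℝ, w = s := ⟨w.re, Complex.ext rfl (by simp [him])⟩
    simp only [Complex.ofReal_im, Complex.ofReal_re] at hw
    rw [← Complex.ofReal_sub, ← Complex.ofReal_sub, ← Complex.ofReal_div,
      Complex.ofReal_mem_slitPlane]
    rcases hw with hw | hw | hw
    · exact absurd rfl hw
    · exact div_pos_of_neg_of_neg (by linarith) (by linarith)
    · exact div_pos (by linarith) (by linarith)
  · right
    rw [Complex.div_im]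
    have hn : Complex.normSq (w - b) ≠ 0 := Complex.normSq_pos.2 h0 |>.ne'
    simp only [Complex.sub_re, Complex.sub_im, Complex.ofReal_re, Complex.ofReal_im, sub_zero]
    rw [← sub_div]
    refine div_ne_zero ?_ hn
    rw [show w.im * (w.re - b) - (w.re - a) * w.im = w.im * (a - b) by ring]
    exact mul_ne_zero him (by linarith)

lemma exists_ratio_eq {a b : ℝ} (hab : a < b) {c : ℂ} (hc : c ∈ Complex.slitPlane) (hc1 : c ≠ 1) :
    ∃ w : ℂ, (w.im ≠ 0 ∨ w.re < a ∨ b < w.re) ∧ (w - a) / (w - b) = c := by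
  have h1 : 1 - c ≠ 0 := sub_ne_zero.2 (Ne.symm hc1)
  have hba : (b : ℂ) - a ≠ 0 := by
    rw [← Complex.ofReal_sub]; exact_mod_cast (sub_pos.2 hab).ne'
  have hw : ((a - b * c) / (1 - c) - b : ℂ) = (a - b) / (1 - c) := by field_simp; ring
  have hwb : ((a - b * c) / (1 - c) - b : ℂ) ≠ 0 := by
    rw [hw]; exact div_ne_zero (by rw [← neg_sub]; exact neg_ne_zero.2 hba) h1
  have heq : ((a - b * c) / (1 - c) - a : ℂ) / ((a - b * c) / (1 - c) - b) = c := by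
    rw [div_eq_iff hwb]
    field_simp
    ring
  refine ⟨_, ?_, heq⟩
  by_contra! hcon
  obtain ⟨h2, h3, h4⟩ := hcon
  obtain ⟨u, hu⟩ : ∃ s : ℝ, ((a - b * c) / (1 - c) : ℂ) = s := ⟨_, Complex.ext rfl (by simp [h2])⟩
  rw [hu] at heq h3 h4
  rw [← heq, ← Complex.ofReal_sub, ← Complex.ofReal_sub, ← Complex.ofReal_div,
    Complex.ofReal_mem_slitPlane] at hc
  simp only [Complex.ofReal_re] at h3 h4
  exact absurd hc (not_lt.2 (div_nonpos_of_nonneg_of_nonpos (by linarith) (by linarith)))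

lemma re_cpow_half_pos {c : ℂ} (hc : c ∈ Complex.slitPlane) : 0 < (c ^ (1 / 2 : ℂ)).re := by
  rw [one_div, Complex.cpow_inv_two_re]
  refine Real.sqrt_pos.2 (half_pos ?_)
  have h1 := neg_abs_le c.re
  rcases hc with h | h
  · positivity
  · have := Complex.abs_re_lt_norm.2 h
    linarith

lemma cpow_half_sq (c : ℂ) : (c ^ (1 / 2 : ℂ)) ^ 2 = c := by
  rw [one_div]
  exact Complex.cpow_ofNat_inv_pow c 2

lemma sq_mem_slitPlane {w : ℂ} (hw : 0 < w.re) : w ^ 2 ∈ Complex.slitPlane := by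
  rw [Complex.mem_slitPlane_iff, sq, Complex.mul_re, Complex.mul_im]
  by_cases him : w.im = 0
  · left; rw [him]; nlinarith
  · right
    rw [show w.re * w.im + w.im * w.re = 2 * w.re * w.im by ring]
    positivity

lemma rho_eq {z : ℝ} (hz : 0 < z) (zr : ℕ → ℝ) (t : ℝ) (x : ℂ) :
    rho z zr t x = z * ratioExt z zr t x ^ (1 / 2 : ℂ) := by
  rcases eq_or_ne x 0 with rfl | hx
  · have : (z : ℂ) ≠ 0 := by exact_mod_cast hz.ne'
    simp [rho, ratioExt, regularI0_zero, this]
  · rw [rho, Function.update_of_ne hx, rhoFormula, ratioExt_eq z zr t hx]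

namespace IsModel

variable {z : ℝ} {zr : ℕ → ℝ} {t : ℝ}

lemma ratio_spec (h : IsModel z zr) (ht0 : t < 0) (ht : (t : ℂ) ∈ curveS (weight z zr)) {x : ℂ}
    (hx : x ∈ starDomain z zr) (hx0 : x ≠ 0) :
    I0 z zr x - I0 z zr 1 ≠ 0 ∧ ratio z zr t x ∈ Complex.slitPlane := by
  have h1 := ratio_mem_slitPlane (h.I0_lt_I0_one ht0 ht) (h.I0_notMem_segment ht0 ht hx hx0)
  have h2 := ofReal_re_I0 z zr 1
  rw [Complex.ofReal_one] at h2
  rwa [ofReal_re_I0, h2] at h1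

lemma ratioExt_zero (h : IsModel z zr) : ratioExt z zr t 0 = 1 := by
  have : (z : ℂ) ≠ 0 := by exact_mod_cast h.pos.ne'
  simp [ratioExt, regularI0_zero, this]

lemma ratioExt_mem_slitPlane (h : IsModel z zr) (ht0 : t < 0)
    (ht : (t : ℂ) ∈ curveS (weight z zr)) {x : ℂ} (hx : x ∈ starDomain z zr) :
    ratioExt z zr t x ∈ Complex.slitPlane := by
  rcases eq_or_ne x 0 with rfl | hx0
  · rw [h.ratioExt_zero]; exact Complex.one_mem_slitPlane
  · rw [ratioExt_eq z zr t hx0]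
    exact (h.ratio_spec ht0 ht hx hx0).2

lemma regularI0_sub_ne_zero (h : IsModel z zr) (ht0 : t < 0)
    (ht : (t : ℂ) ∈ curveS (weight z zr)) {x : ℂ} (hx : x ∈ starDomain z zr) :
    regularI0 z zr x - I0 z zr 1 * x ≠ 0 := by
  rcases eq_or_ne x 0 with rfl | hx0
  · rw [regularI0_zero, mul_zero, sub_zero]; exact_mod_cast h.pos.ne'
  · rw [← mul_I0 z zr hx0, mul_comm x, ← sub_mul]
    exact mul_ne_zero (h.ratio_spec ht0 ht hx hx0).1 hx0

lemma differentiableAt_ratioExt (h : IsModel z zr) (ht0 : t < 0)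
    (ht : (t : ℂ) ∈ curveS (weight z zr)) {x : ℂ} (hx : x ∈ starDomain z zr) :
    DifferentiableAt ℂ (ratioExt z zr t) x := by
  have h1 := (h.hasDerivAt_regularI0 (h.norm_lt_one_of_mem hx)).differentiableAt
  exact (h1.sub (by fun_prop)).div (h1.sub (by fun_prop)) (h.regularI0_sub_ne_zero ht0 ht hx)

lemma differentiableAt_rho (h : IsModel z zr) (ht0 : t < 0)
    (ht : (t : ℂ) ∈ curveS (weight z zr)) {x : ℂ} (hx : x ∈ starDomain z zr) :
    DifferentiableAt ℂ (rho z zr t) x := by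
  rw [show rho z zr t = fun x => z * ratioExt z zr t x ^ (1 / 2 : ℂ) from
    funext (rho_eq h.pos zr t)]
  exact ((h.differentiableAt_ratioExt ht0 ht hx).cpow_const
    (h.ratioExt_mem_slitPlane ht0 ht hx)).const_mul _

lemma injOn_ratioExt (h : IsModel z zr) (ht0 : t < 0) (ht : (t : ℂ) ∈ curveS (weight z zr)) :
    Set.InjOn (ratioExt z zr t) (starDomain z zr) := by
  have hab := h.I0_lt_I0_one ht0 ht
  have hab' : I0 z zr 1 - I0 z zr t ≠ 0 := by
    intro h0
    rw [sub_eq_zero.1 h0] at hab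
    exact lt_irrefl _ hab
  have hne : ∀ x ∈ starDomain z zr, x ≠ 0 → ratioExt z zr t x ≠ 1 := by
    intro x hx hx0 h1
    rw [ratioExt_eq z zr t hx0, ratio, div_eq_one_iff_eq (h.ratio_spec ht0 ht hx hx0).1] at h1
    exact hab' (by linear_combination h1)
  intro x hx y hy hxy
  rcases eq_or_ne x 0 with rfl | hx0
  · by_contra hne'
    exact hne y hy (Ne.symm hne') (by rw [← hxy, h.ratioExt_zero])
  rcases eq_or_ne y 0 with rfl | hy0
  · exact absurd (by rw [hxy, h.ratioExt_zero]) (hne x hx hx0)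
  refine h.injOn_I0 ht0 ht ⟨hx, hx0⟩ ⟨hy, hy0⟩ ?_
  rw [ratioExt_eq z zr t hx0, ratioExt_eq z zr t hy0, ratio, ratio,
    div_eq_div_iff (h.ratio_spec ht0 ht hx hx0).1 (h.ratio_spec ht0 ht hy hy0).1] at hxy
  have h2 : (I0 z zr 1 - I0 z zr t) * (I0 z zr x - I0 z zr y) = 0 := by
    linear_combination -hxy
  exact sub_eq_zero.1 ((mul_eq_zero.1 h2).resolve_left hab')

lemma surjOn_ratioExt (h : IsModel z zr) (ht0 : t < 0) (ht : (t : ℂ) ∈ curveS (weight z zr)) :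
    Set.SurjOn (ratioExt z zr t) (starDomain z zr) Complex.slitPlane := by
  intro c hc
  rcases eq_or_ne c 1 with rfl | hc1
  · exact ⟨0, h.zero_mem_starDomain, h.ratioExt_zero⟩
  · obtain ⟨w, hw, hwc⟩ := exists_ratio_eq (h.I0_lt_I0_one ht0 ht) hc hc1
    obtain ⟨x, hx, hx0, hxw⟩ := h.exists_I0_eq ht0 ht hw
    refine ⟨x, hx, ?_⟩
    have h2 := ofReal_re_I0 z zr 1
    rw [Complex.ofReal_one] at h2
    rw [ratioExt_eq z zr t hx0, ratio, hxw, ← hwc, ofReal_re_I0, h2]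

/-- The map `ρ` is conformal from the interior of the curve onto the right half-plane, being
composed of `I₀` onto the complement of a segment in the Riemann sphere, a Möbius map onto the slit
plane and the square root. -/
lemma isConformalOnto_rho (h : IsModel z zr) (ht0 : t < 0) (ht : (t : ℂ) ∈ curveS (weight z zr)) :
    IsConformalOnto (rho z zr t) (starDomain z zr) rightHalfPlane := by
  have hz : (z : ℂ) ≠ 0 := by exact_mod_cast h.pos.ne'
  refine ⟨fun x hx => (h.differentiableAt_rho ht0 ht hx).differentiableWithinAt, ?_, ?_, ?_⟩
  · intro x hx
    rw [rightHalfPlane, Set.mem_ofPred_eq, rho_eq h.pos, Complex.re_ofReal_mul]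
    exact mul_pos h.pos (re_cpow_half_pos (h.ratioExt_mem_slitPlane ht0 ht hx))
  · intro x hx y hy hxy
    rw [rho_eq h.pos, rho_eq h.pos] at hxy
    have := mul_left_cancel₀ hz hxy
    refine h.injOn_ratioExt ht0 ht hx hy ?_
    rw [← cpow_half_sq (ratioExt z zr t x), ← cpow_half_sq (ratioExt z zr t y), this]
  · intro w hw
    have hwz : 0 < (w / z).re := by
      rw [Complex.div_ofReal_re]; exact div_pos hw h.pos
    obtain ⟨x, hx, hxw⟩ := h.surjOn_ratioExt ht0 ht (sq_mem_slitPlane hwz)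
    refine ⟨x, hx, ?_⟩
    rw [rho_eq h.pos, hxw, one_div, Complex.sq_cpow_two_inv hwz, mul_div_cancel₀ _ hz]

lemma hasDerivAt_rho_zero (h : IsModel z zr) :
    HasDerivAt (rho z zr t) ((((I0 z zr 1).re - (I0 z zr t).re) / 2 : ℝ) : ℂ) 0 := by
  have hz : (z : ℂ) ≠ 0 := by exact_mod_cast h.pos.ne'
  rw [show rho z zr t = fun x => z * ratioExt z zr t x ^ (1 / 2 : ℂ) from
    funext (rho_eq h.pos zr t)]
  have h1 := h.hasDerivAt_regularI0 (x := 0) (by simp)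
  have h0 : stepSum zr 0 = 0 := by simp [stepSum]
  rw [h0] at h1
  have h2 : ∀ a : ℂ, HasDerivAt (fun x => regularI0 z zr x - a * x) (-a) 0 := fun a =>
    (h1.sub ((hasDerivAt_id (0 : ℂ)).const_mul a)).congr_deriv (by simp)
  have h3 := (h2 (I0 z zr t)).div (h2 (I0 z zr 1)) (by simpa [regularI0_zero] using hz)
  have h4 : HasDerivAt (ratioExt z zr t) ((I0 z zr 1 - I0 z zr t) / z) 0 := by
    refine h3.congr_deriv ?_
    simp only [regularI0_zero, mul_zero, sub_zero]
    field_simp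
    ring
  have h5 := (h4.cpow_const (c := 1 / 2) (by
    rw [h.ratioExt_zero]; exact Complex.one_mem_slitPlane)).const_mul (z : ℂ)
  refine h5.congr_deriv ?_
  have e := ofReal_re_I0 z zr 1
  rw [Complex.ofReal_one] at e
  rw [h.ratioExt_zero, Complex.one_cpow]
  push_cast
  rw [e, ofReal_re_I0]
  field_simp

lemma tendsto_rhoFormula (h : IsModel z zr) :
    Tendsto (rhoFormula z zr t) (𝓝[≠] 0) (𝓝 (z : ℂ)) := by
  have h1 := (h.hasDerivAt_rho_zero (t := t)).continuousAt.tendsto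
  have h2 : rho z zr t 0 = z := by simp [rho]
  rw [h2] at h1
  refine (h1.mono_left nhdsWithin_le_nhds).congr' ?_
  filter_upwards [self_mem_nhdsWithin] with x hx
  rw [rho, Function.update_of_ne hx]

end IsModel

/-! ### Uniqueness of the normalized conformal map -/

lemma not_eventually_const_of_injOn {f : ℂ → ℂ} {U : Set ℂ} (hU : IsOpen U) (hinj : Set.InjOn f U)
    {x : ℂ} (hx : x ∈ U) : ¬ ∀ᶠ u in 𝓝 x, f u = f x := by
  intro hc
  have h1 : ∀ᶠ u in 𝓝[≠] x, f u = f x ∧ u ∈ U := (hc.and (hU.mem_nhds hx)).filter_mono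
    nhdsWithin_le_nhds
  obtain ⟨u, ⟨h2, h3⟩, h4⟩ := (h1.and self_mem_nhdsWithin).exists
  exact h4 (hinj h3 hx h2)

/-- A holomorphic bijection has a holomorphic inverse. The zeros of the derivative are isolated, and
the inverse is continuous by the open mapping theorem, so that the singularities of the inverse are
removable. -/
lemma exists_differentiableOn_inverse {f : ℂ → ℂ} {U V : Set ℂ} (hU : IsOpen U)
    (hf : IsConformalOnto f U V) :
    ∃ g : ℂ → ℂ, DifferentiableOn ℂ g V ∧ Set.MapsTo g V U ∧ (∀ x ∈ U, g (f x) = x) ∧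
      ∀ w ∈ V, f (g w) = w := by
  obtain ⟨hd, hmaps, hinj, hsurj⟩ := hf
  have hleft : ∀ x ∈ U, Function.invFunOn f U (f x) = x := fun x hx =>
    hinj.leftInvOn_invFunOn hx
  have hright : ∀ w ∈ V, f (Function.invFunOn f U w) = w := fun w hw =>
    hsurj.rightInvOn_invFunOn hw
  refine ⟨Function.invFunOn f U, ?_, hsurj.mapsTo_invFunOn, hleft, hright⟩
  set g := Function.invFunOn f U
  -- an injective holomorphic function is nowhere locally constant, hence open
  have hopen : ∀ x ∈ U, 𝓝 (f x) ≤ map f (𝓝 x) := fun x hx =>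
    (hd.analyticAt (hU.mem_nhds hx)).eventually_constant_or_nhds_le_map_nhds.resolve_left
      (not_eventually_const_of_injOn hU hinj hx)
  have hcont : ∀ x ∈ U, Tendsto g (𝓝 (f x)) (𝓝 x) := by
    intro x hx
    refine (tendsto_map'_iff.2 ?_).mono_left (hopen x hx)
    exact tendsto_id.congr' (by filter_upwards [hU.mem_nhds hx] with u hu using (hleft u hu).symm)
  have hVn : ∀ x ∈ U, V ∈ 𝓝 (f x) := fun x hx => hopen x hx (mem_map.2 (by
    filter_upwards [hU.mem_nhds hx] with u hu using hmaps hu))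
  have hcont' : ∀ x ∈ U, ContinuousAt g (f x) := fun x hx => by
    rw [ContinuousAt, hleft x hx]; exact hcont x hx
  have hreg : ∀ x ∈ U, deriv f x ≠ 0 → DifferentiableAt ℂ g (f x) := by
    intro x hx hx'
    have h1 := (hd.differentiableAt (hU.mem_nhds hx)).hasDerivAt
    rw [← hleft x hx] at h1
    refine (HasDerivAt.of_local_left_inverse (hcont' x hx) h1
      (by rwa [hleft x hx]) ?_).differentiableAt
    filter_upwards [hVn x hx] with w hw using hright w hw
  intro w hw
  obtain ⟨x, hx, rfl⟩ := hsurj hw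
  have han := (hd.analyticAt (hU.mem_nhds hx)).deriv
  have hne : ∀ᶠ u in 𝓝[≠] x, deriv f u ≠ 0 := by
    refine han.eventually_eq_zero_or_eventually_ne_zero.resolve_left fun h0 => ?_
    obtain ⟨ε, hε, hb⟩ := Metric.eventually_nhds_iff_ball.1 (h0.and (hU.mem_nhds hx))
    refine not_eventually_const_of_injOn hU hinj hx ?_
    filter_upwards [Metric.ball_mem_nhds x hε] with u hu
    exact Metric.isOpen_ball.is_const_of_deriv_eq_zero (convex_ball x ε).isPreconnected
      (hd.mono fun y hy => (hb y hy).2) (fun y hy => (hb y hy).1) hu (Metric.mem_ball_self hε)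
  have hg0 : Tendsto g (𝓝[≠] (f x)) (𝓝[≠] x) := by
    refine tendsto_nhdsWithin_iff.2 ⟨(hcont x hx).mono_left nhdsWithin_le_nhds, ?_⟩
    filter_upwards [self_mem_nhdsWithin, nhdsWithin_le_nhds (hVn x hx)] with w hwx hwV hgw
    have hgw : g w = x := hgw
    exact hwx (by rw [Set.mem_singleton_iff, ← hgw, hright w hwV])
  refine (Complex.analyticAt_of_differentiable_on_punctured_nhds_of_continuousAt ?_
    (hcont' x hx)).differentiableAt.differentiableWithinAt
  filter_upwards [hg0.eventually hne, nhdsWithin_le_nhds (hVn x hx)] with w hw hwV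
  have := hreg (g w) (hsurj.mapsTo_invFunOn hwV) hw
  rwa [hright w hwV] at this

/-- The Cayley transform of the right half-plane onto the unit disc that sends `z` to `0`. -/
def cayley (z : ℝ) (w : ℂ) : ℂ := (w - z) / (w + z)

/-- The inverse of the Cayley transform. -/
def cayleyInv (z : ℝ) (u : ℂ) : ℂ := z * (1 + u) / (1 - u)

lemma add_ofReal_ne_zero {z : ℝ} (hz : 0 < z) {w : ℂ} (hw : w ∈ rightHalfPlane) :
    w + z ≠ 0 := by
  intro h0
  have h1 := congrArg Complex.re h0
  have hw : 0 < w.re := hw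
  simp at h1
  linarith

lemma norm_cayley_lt_one {z : ℝ} (hz : 0 < z) {w : ℂ} (hw : w ∈ rightHalfPlane) :
    ‖cayley z w‖ < 1 := by
  rw [cayley, norm_div, div_lt_one (norm_pos_iff.2 (add_ofReal_ne_zero hz hw))]
  have hw : 0 < w.re := hw
  rw [← sq_lt_sq₀ (norm_nonneg _) (norm_nonneg _), ← Complex.normSq_eq_norm_sq,
    ← Complex.normSq_eq_norm_sq, Complex.normSq_apply, Complex.normSq_apply]
  simp
  nlinarith [mul_pos hw hz]

lemma one_sub_ne_zero_of_norm_lt_one {u : ℂ} (hu : ‖u‖ < 1) : 1 - u ≠ 0 := by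
  intro h0
  rw [← sub_eq_zero.1 h0] at hu
  simp at hu

lemma cayleyInv_mem {z : ℝ} (hz : 0 < z) {u : ℂ} (hu : ‖u‖ < 1) :
    cayleyInv z u ∈ rightHalfPlane := by
  have h1 := one_sub_ne_zero_of_norm_lt_one hu
  have h2 : 0 < Complex.normSq (1 - u) := Complex.normSq_pos.2 h1
  have h3 : u.re * u.re + u.im * u.im < 1 := by
    rw [← Complex.normSq_apply, Complex.normSq_eq_norm_sq]
    exact pow_lt_one₀ (norm_nonneg _) hu two_ne_zero
  rw [rightHalfPlane, Set.mem_ofPred_eq, cayleyInv, mul_div_assoc, Complex.re_ofReal_mul]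
  refine mul_pos hz ?_
  rw [Complex.div_re, ← add_div]
  refine div_pos ?_ h2
  simp
  nlinarith

lemma cayleyInv_cayley {z : ℝ} (hz : 0 < z) {w : ℂ} (hw : w ∈ rightHalfPlane) :
    cayleyInv z (cayley z w) = w := by
  have h1 := add_ofReal_ne_zero hz hw
  have hz' : (z : ℂ) ≠ 0 := by exact_mod_cast hz.ne'
  have h2 := one_sub_ne_zero_of_norm_lt_one (norm_cayley_lt_one hz hw)
  rw [cayleyInv, div_eq_iff h2, cayley]
  field_simp
  ring

lemma cayley_cayleyInv {z : ℝ} (hz : 0 < z) {u : ℂ} (hu : ‖u‖ < 1) :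
    cayley z (cayleyInv z u) = u := by
  have h1 := add_ofReal_ne_zero hz (cayleyInv_mem hz hu)
  have h2 := one_sub_ne_zero_of_norm_lt_one hu
  rw [cayley, div_eq_iff h1, cayleyInv]
  field_simp
  ring

/-- Two conformal maps onto the right half-plane with the same value `z` at `p` differ by a
holomorphic self-map of the unit disc that fixes the origin. -/
lemma exists_disc_map {f g : ℂ → ℂ} {U : Set ℂ} (hU : IsOpen U) {z : ℝ} (hz : 0 < z) {p : ℂ}
    (hp : p ∈ U) (hf : IsConformalOnto f U rightHalfPlane)
    (hg : IsConformalOnto g U rightHalfPlane) (hfp : f p = z) (hgp : g p = z) :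
    ∃ φ : ℂ → ℂ, DifferentiableOn ℂ φ (Metric.ball 0 1) ∧
      Set.MapsTo φ (Metric.ball 0 1) (Metric.ball 0 1) ∧ φ 0 = 0 ∧
      ∀ x ∈ U, φ (cayley z (g x)) = cayley z (f x) := by
  obtain ⟨k, hkd, hkm, hkl, hkr⟩ := exists_differentiableOn_inverse hU hg
  have hball : ∀ u ∈ Metric.ball (0 : ℂ) 1, ‖u‖ < 1 := fun u hu => by simpa using hu
  have hval : ∀ x ∈ U, cayley z (f (k (cayleyInv z (cayley z (g x))))) = cayley z (f x) :=
    fun x hx => by rw [cayleyInv_cayley hz (hg.2.mapsTo hx), hkl x hx]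
  refine ⟨fun u => cayley z (f (k (cayleyInv z u))), ?_, ?_, ?_, hval⟩
  · have h1 : DifferentiableOn ℂ (cayleyInv z) (Metric.ball 0 1) := fun u hu =>
      DifferentiableAt.differentiableWithinAt <|
        DifferentiableAt.div (by fun_prop) (by fun_prop)
          (one_sub_ne_zero_of_norm_lt_one (hball u hu))
    have h2 : DifferentiableOn ℂ (cayley z) rightHalfPlane := fun w hw =>
      DifferentiableAt.differentiableWithinAt <|
        DifferentiableAt.div (by fun_prop) (by fun_prop) (add_ofReal_ne_zero hz hw)
    have m1 : Set.MapsTo (cayleyInv z) (Metric.ball 0 1) rightHalfPlane := fun u hu =>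
      cayleyInv_mem hz (hball u hu)
    exact h2.comp (hf.1.comp (hkd.comp h1 m1) (hkm.comp m1)) (hf.2.mapsTo.comp (hkm.comp m1))
  · intro u hu
    simpa using norm_cayley_lt_one hz (hf.2.mapsTo (hkm (cayleyInv_mem hz (hball u hu))))
  · have := hval p hp
    rwa [hgp, hfp, show cayley z z = 0 by simp [cayley]] at this

/-- Two conformal maps onto the right half-plane with the same value and derivatives of the same
sign at one point coincide, by the Schwarz lemma applied in both directions. -/
lemma eqOn_of_isConformalOnto {f g : ℂ → ℂ} {U : Set ℂ} (hU : IsOpen U) {z : ℝ} (hz : 0 < z)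
    {p : ℂ} (hp : p ∈ U) (hf : IsConformalOnto f U rightHalfPlane)
    (hg : IsConformalOnto g U rightHalfPlane) (hfp : f p = z) (hgp : g p = z) {c d : ℝ}
    (hc : 0 < c) (hd : 0 < d) (hfc : HasDerivAt f c p) (hgd : HasDerivAt g d p) :
    Set.EqOn f g U := by
  obtain ⟨φ, hφd, hφm, hφ0, hφ⟩ := exists_disc_map hU hz hp hf hg hfp hgp
  obtain ⟨χ, hχd, hχm, hχ0, hχ⟩ := exists_disc_map hU hz hp hg hf hgp hfp
  have hle : ∀ x ∈ U, ‖cayley z (f x)‖ = ‖cayley z (g x)‖ := fun x hx => by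
    have h1 := Complex.norm_le_norm_of_mapsTo_ball hφd
      (hφm.mono_right Metric.ball_subset_closedBall) hφ0
      (norm_cayley_lt_one hz (hg.2.mapsTo hx))
    have h2 := Complex.norm_le_norm_of_mapsTo_ball hχd
      (hχm.mono_right Metric.ball_subset_closedBall) hχ0
      (norm_cayley_lt_one hz (hf.2.mapsTo hx))
    rw [hφ x hx] at h1
    rw [hχ x hx] at h2
    exact le_antisymm h1 h2
  have hhalf : ‖(1 / 2 : ℂ)‖ < 1 := by norm_num
  -- equality of the moduli at the point `1/2` of the disc makes the disc map a rotation
  obtain ⟨y, hy, hyg⟩ := hg.2.surjOn (cayleyInv_mem hz hhalf)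
  have hyu : cayley z (g y) = 1 / 2 := by rw [hyg, cayley_cayleyInv hz hhalf]
  have hnorm : ‖φ (1 / 2)‖ = 1 / 2 := by
    rw [← hyu, hφ y hy, hle y hy, hyu]; norm_num
  have hslope : ‖dslope φ 0 (1 / 2)‖ = 1 / 1 := by
    rw [dslope_of_ne _ (by norm_num), slope_def_field, hφ0, sub_zero, sub_zero, norm_div, hnorm]
    norm_num
  have haff := Complex.affine_of_mapsTo_ball_of_norm_dslope_eq_div hφd
    (R₂ := 1) (by rw [hφ0]; exact hφm.mono_right Metric.ball_subset_closedBall)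
    (by simpa using hhalf) hslope
  set k := dslope φ 0 (1 / 2) with hk
  have hkey : ∀ x ∈ U, cayley z (f x) = cayley z (g x) * k := fun x hx => by
    have := haff (show cayley z (g x) ∈ Metric.ball 0 1 by
      simpa using norm_cayley_lt_one hz (hg.2.mapsTo hx))
    rw [hφ x hx] at this
    simpa [hφ0] using this
  -- comparing derivatives at `p` shows that the rotation factor is positive
  have hz' : (z : ℂ) ≠ 0 := by exact_mod_cast hz.ne'
  have hcay : ∀ {q : ℂ → ℂ} {e : ℂ}, HasDerivAt q e p → q p = z →
      HasDerivAt (fun x => cayley z (q x)) (e / (2 * z)) p := by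
    intro q e hq hqp
    have := (hq.sub_const (z : ℂ)).div (hq.add_const (z : ℂ))
      (by rw [hqp, ← two_mul]; exact mul_ne_zero two_ne_zero hz')
    refine this.congr_deriv ?_
    rw [hqp]
    field_simp
    ring
  have hd1 := hcay hfc hfp
  have hd2 := (hcay hgd hgp).mul_const k
  have hd3 := hd1.unique (hd2.congr_of_eventuallyEq (by
    filter_upwards [hU.mem_nhds hp] with x hx using hkey x hx))
  have hd' : (d : ℂ) ≠ 0 := by exact_mod_cast hd.ne'
  have hkc : k = ((c / d : ℝ) : ℂ) := by
    push_cast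
    field_simp at hd3 ⊢
    rw [hd3]
  have hk1 : k = 1 := by
    rw [hkc, Complex.norm_real, Real.norm_of_nonneg (by positivity), div_one] at hslope
    rw [hkc, hslope, Complex.ofReal_one]
  intro x hx
  have := hkey x hx
  rw [hk1, mul_one] at this
  rw [← cayleyInv_cayley hz (hf.2.mapsTo hx), this, cayleyInv_cayley hz (hg.2.mapsTo hx)]

/-! ### Harmonic functions from double power series -/

/-- The product of two absolutely convergent double series, arranged as a Cauchy product. -/
lemma hasSum_prod_conv {F G : ℕ × ℕ → ℂ} (hF : Summable fun m => ‖F m‖)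
    (hG : Summable fun m => ‖G m‖) :
    HasSum (fun n : ℕ × ℕ => ∑ a ∈ Finset.range (n.1 + 1), ∑ b ∈ Finset.range (n.2 + 1),
      F (a, b) * G (n.1 - a, n.2 - b)) ((∑' m, F m) * ∑' m, G m) := by
  let _ : Finset.HasAntidiagonal (ℕ × ℕ) := Finset.HasAntidiagonal.antidiagonalOfLocallyFinite
  have hs := summable_mul_of_summable_norm hF hG
  have h1 := hs.hasSum
  rw [← tsum_mul_tsum_of_summable_norm hF hG,
    ← (Finset.HasAntidiagonal.sigmaAntidiagonalEquivProd (A := ℕ × ℕ)).hasSum_iff] at h1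
  refine h1.sigma fun n => ?_
  have h2 := hasSum_fintype (fun c : Finset.HasAntidiagonal.antidiagonal n => F c.1.1 * G c.1.2)
  rw [Finset.sum_coe_sort (Finset.HasAntidiagonal.antidiagonal n)
    (fun p => F p.1 * G p.2)] at h2
  refine (congrArg (HasSum _) ?_).mp h2
  rw [← Finset.sum_product']
  symm
  refine Finset.sum_nbij' (fun q => (q, n - q)) (fun p => p.1) ?_ ?_ ?_ ?_ ?_
  · rintro ⟨a, b⟩ hq
    simp only [Finset.mem_product, Finset.mem_range] at hq
    rw [Finset.HasAntidiagonal.mem_antidiagonal]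
    ext <;> simp <;> omega
  · rintro ⟨⟨a, b⟩, ⟨c, d⟩⟩ hq
    rw [Finset.HasAntidiagonal.mem_antidiagonal] at hq
    simp only [Finset.mem_product, Finset.mem_range, ← hq, Prod.mk_add_mk]
    omega
  · intro q _; rfl
  · rintro ⟨⟨a, b⟩, ⟨c, d⟩⟩ hq
    rw [Finset.HasAntidiagonal.mem_antidiagonal] at hq
    simp [← hq]
  · rintro ⟨a, b⟩ _; rfl

/-- The coefficients of the double power series `(f(x) - g(y)) / K(x,y)`, for `f = ∑ α_i x^i` and
`g = ∑ β_j y^j`, obtained by comparing coefficients in `K(x,y) H(x,y) = f(x) - g(y)`. -/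
def quotientCoeff (z : ℝ) (zr : ℕ → ℝ) (α β : ℕ → ℝ) : ℕ → ℕ → ℝ
  | 0, 0 => (β 0 - α 0) / z
  | 0, j + 1 => β (j + 1) / z
  | i + 1, 0 => -α (i + 1) / z
  | i + 1, j + 1 => (quotientCoeff z zr α β i j - ∑ a : Fin (i + 1), ∑ b ∈ Finset.range (j + 1),
      zr (a + b) * quotientCoeff z zr α β (i - a) (j - b)) / z
termination_by i => i

lemma quotientCoeff_succ_succ (z : ℝ) (zr : ℕ → ℝ) (α β : ℕ → ℝ) (i j : ℕ) :
    quotientCoeff z zr α β (i + 1) (j + 1) =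
      (quotientCoeff z zr α β i j - ∑ a ∈ Finset.range (i + 1), ∑ b ∈ Finset.range (j + 1),
        zr (a + b) * quotientCoeff z zr α β (i - a) (j - b)) / z := by
  rw [quotientCoeff, Finset.sum_range (fun a => ∑ b ∈ Finset.range (j + 1),
        zr (a + b) * quotientCoeff z zr α β (i - a) (j - b))]

/-- The function on `ℤ²` with coefficients `c`, shifted by `(1,1)` and extended by zero. -/
def shiftedCoeff (c : ℕ → ℕ → ℝ) (i j : ℤ) : ℝ :=
  if 1 ≤ i ∧ 1 ≤ j then c (i - 1).toNat (j - 1).toNat else 0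

lemma shiftedCoeff_natCast (c : ℕ → ℕ → ℝ) (i j : ℕ) :
    shiftedCoeff c ((i : ℤ) + 1) ((j : ℤ) + 1) = c i j := by
  rw [shiftedCoeff, if_pos (by omega)]
  simp

/-- For an analytic function that commutes with complex conjugation, the power series may be taken
with real coefficients: average the series with its conjugate. -/
lemma exists_real_coeff {f : ℂ → ℂ} (hf : AnalyticAt ℂ f 0)
    (hconj : ∀ᶠ x in 𝓝 (0 : ℂ), f (starRingEnd ℂ x) = starRingEnd ℂ (f x)) :
    ∃ (α : ℕ → ℝ) (B L : ℝ), 0 ≤ B ∧ 1 ≤ L ∧ (∀ i, |α i| ≤ B * L ^ i) ∧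
      ∀ᶠ x in 𝓝 (0 : ℂ), HasSum (fun i => (α i : ℂ) * x ^ i) (f x) := by
  obtain ⟨p, hp⟩ := hf
  rw [hasFPowerSeriesAt_iff] at hp
  simp only [zero_add] at hp
  obtain ⟨ε, hε, hb⟩ := Metric.eventually_nhds_iff_ball.1 hp
  obtain ⟨r, hr⟩ : ∃ r, r = min (ε / 2) 1 := ⟨_, rfl⟩
  have hr0 : 0 < r := hr ▸ lt_min (half_pos hε) one_pos
  have hrε : r < ε := by
    rw [hr]; exact (min_le_left _ _).trans_lt (half_lt_self hε)
  have hsum := (hb (r : ℂ) (by simpa [abs_of_pos hr0] using hrε)).summable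
  obtain ⟨B, hB⟩ := (hsum.tendsto_atTop_zero.norm.isBoundedUnder_le.bddAbove_range)
  refine ⟨fun i => (p.coeff i).re, B, 1 / r, ?_, ?_, fun i => ?_, ?_⟩
  · exact (norm_nonneg _).trans (hB ⟨0, rfl⟩)
  · rw [le_div_iff₀ hr0, one_mul, hr]; exact min_le_right _ _
  · have h1 := hB ⟨i, rfl⟩
    simp only [norm_smul, norm_pow, Complex.norm_real, Real.norm_of_nonneg hr0.le] at h1
    rw [one_div, inv_pow, ← div_eq_mul_inv, le_div_iff₀ (by positivity), mul_comm]
    exact (mul_le_mul_of_nonneg_left (Complex.abs_re_le_norm _) (by positivity)).trans h1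
  · have hc : Tendsto (starRingEnd ℂ) (𝓝 0) (𝓝 0) := by
      simpa using Complex.continuous_conj.tendsto 0
    filter_upwards [hp, hc.eventually hp, hconj] with x h1 h2 h3
    rw [h3] at h2
    have h4 := Complex.hasSum_conj'.2 h2
    have h5 := (h1.add h4).div_const 2
    rw [Complex.conj_conj, add_self_div_two] at h5
    refine (congrArg (HasSum · _) (funext fun i => ?_)).mp h5
    simp only [smul_eq_mul, Complex.re_eq_add_conj, map_mul, map_pow, Complex.conj_conj]
    ring

namespace IsModel

variable {z : ℝ} {zr : ℕ → ℝ} {t : ℝ} {α β : ℕ → ℝ}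

lemma isQuadrantHarmonic_shiftedCoeff (h : IsModel z zr) (α β : ℕ → ℝ) :
    IsQuadrantHarmonic (weight z zr) (shiftedCoeff (quotientCoeff z zr α β)) := by
  refine ⟨fun i j hij => ?_, fun i j hi hj => ?_⟩
  · rw [shiftedCoeff, if_neg (by omega)]
  obtain ⟨m, rfl⟩ : ∃ m : ℕ, i = m + 1 := ⟨(i - 1).toNat, by omega⟩
  obtain ⟨n, rfl⟩ : ∃ n : ℕ, j = n + 1 := ⟨(j - 1).toNat, by omega⟩
  set c := quotientCoeff z zr α β with hc
  have h1 : HasSum (fun q : ℕ × ℕ => zr (q.1 + q.2) •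
      shiftedCoeff c ((m : ℤ) + 1 + -(q.1 : ℤ)) ((n : ℤ) + 1 + -(q.2 : ℤ)))
      (∑ q ∈ Finset.range (m + 1) ×ˢ Finset.range (n + 1),
        zr (q.1 + q.2) * c (m - q.1) (n - q.2)) := by
    have h2 := hasSum_sum_of_ne_finset_zero (L := SummationFilter.unconditional _)
      (s := Finset.range (m + 1) ×ˢ Finset.range (n + 1))
      (f := fun q : ℕ × ℕ => zr (q.1 + q.2) •
      shiftedCoeff c ((m : ℤ) + 1 + -(q.1 : ℤ)) ((n : ℤ) + 1 + -(q.2 : ℤ))) (by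
        rintro ⟨a, b⟩ hab
        simp only [Finset.mem_product, Finset.mem_range, not_and_or] at hab
        rw [shiftedCoeff, if_neg (by omega), smul_zero])
    refine (congrArg (HasSum _) (Finset.sum_congr rfl ?_)).mp h2
    rintro ⟨a, b⟩ hab
    simp only [Finset.mem_product, Finset.mem_range] at hab
    rw [smul_eq_mul, ← shiftedCoeff_natCast c (m - a) (n - b)]
    congr 2 <;> omega
  have h3 := (hasSum_weight_smul (z := z)
    (G := fun s : ℤ × ℤ => shiftedCoeff c ((m : ℤ) + 1 + s.1) ((n : ℤ) + 1 + s.2)) h1).tsum_eq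
  simp only [smul_eq_mul] at h3
  rw [laplacian, h3, shiftedCoeff_natCast, Finset.sum_product]
  have h4 := shiftedCoeff_natCast c (m + 1) (n + 1)
  push_cast at h4
  rw [h4, hc, quotientCoeff_succ_succ, mul_div_cancel₀ _ h.pos.ne']
  ring

lemma sum_range_le (h : IsModel z zr) (i j : ℕ) :
    ∑ a ∈ Finset.range i, ∑ b ∈ Finset.range j, zr (a + b) ≤ 1 := by
  rw [← Finset.sum_product' (f := fun a b => zr (a + b))]
  have := sum_le_hasSum (Finset.range i ×ˢ Finset.range j) (fun m _ => h.nonneg _) h.hasSum_prod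
  linarith [h.pos]

lemma abs_quotientCoeff_le (h : IsModel z zr) {B L : ℝ} (hB : 0 ≤ B) (hL : 1 ≤ L)
    (hLz : 2 ≤ z * L ^ 2) (hα : ∀ i, |α i| ≤ B * L ^ i) (hβ : ∀ i, |β i| ≤ B * L ^ i) (i j : ℕ) :
    |quotientCoeff z zr α β i j| ≤ 2 * B / z * (L ^ i * L ^ j) := by
  have hz := h.pos
  have hL0 : 0 < L := by linarith
  induction i using Nat.strong_induction_on generalizing j with
  | _ i ih =>
  rcases i with _ | i
  · rcases j with _ | j
    · rw [quotientCoeff, abs_div, abs_of_pos hz]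
      have h1 := (abs_sub (β 0) (α 0)).trans (add_le_add (hβ 0) (hα 0))
      simp only [pow_zero, mul_one] at h1 ⊢
      gcongr
      linarith
    · rw [quotientCoeff, abs_div, abs_of_pos hz, pow_zero, one_mul, div_mul_eq_mul_div]
      gcongr
      refine (hβ _).trans ?_
      have : 0 ≤ B * L ^ (j + 1) := by positivity
      linarith
  · rcases j with _ | j
    · rw [quotientCoeff, abs_div, abs_of_pos hz, abs_neg, pow_zero, mul_one, div_mul_eq_mul_div]
      gcongr
      refine (hα _).trans ?_
      have : 0 ≤ B * L ^ (i + 1) := by positivity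
      linarith
    · rw [quotientCoeff_succ_succ, abs_div, abs_of_pos hz, div_le_iff₀ hz]
      set C := 2 * B / z * (L ^ i * L ^ j) with hC
      have hC0 : 0 ≤ C := by positivity
      have h1 : |quotientCoeff z zr α β i j| ≤ C := ih i (Nat.lt_succ_self i) j
      have h2 : |∑ a ∈ Finset.range (i + 1), ∑ b ∈ Finset.range (j + 1),
          zr (a + b) * quotientCoeff z zr α β (i - a) (j - b)| ≤ C := by
        calc _ ≤ ∑ a ∈ Finset.range (i + 1), ∑ b ∈ Finset.range (j + 1), zr (a + b) * C := by
              refine (Finset.abs_sum_le_sum_abs _ _).trans (Finset.sum_le_sum fun a _ => ?_)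
              refine (Finset.abs_sum_le_sum_abs _ _).trans (Finset.sum_le_sum fun b _ => ?_)
              rw [abs_mul, abs_of_nonneg (h.nonneg _)]
              refine mul_le_mul_of_nonneg_left ?_ (h.nonneg _)
              refine (ih (i - a) (by omega) (j - b)).trans ?_
              rw [hC]
              gcongr <;> first | exact hL | omega
          _ = (∑ a ∈ Finset.range (i + 1), ∑ b ∈ Finset.range (j + 1), zr (a + b)) * C := by
              simp only [Finset.sum_mul]
          _ ≤ 1 * C := mul_le_mul_of_nonneg_right (h.sum_range_le _ _) hC0
          _ = C := one_mul C
      have h3 := (abs_sub (quotientCoeff z zr α β i j) (∑ a ∈ Finset.range (i + 1),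
        ∑ b ∈ Finset.range (j + 1),
          zr (a + b) * quotientCoeff z zr α β (i - a) (j - b))).trans (add_le_add h1 h2)
      refine h3.trans ?_
      have h4 : 2 * B / z * (L ^ (i + 1) * L ^ (j + 1)) * z = C * (z * L ^ 2) := by
        rw [hC]; ring
      rw [h4]
      nlinarith

lemma summable_quotient (h : IsModel z zr) {B L : ℝ} (hB : 0 ≤ B) (hL : 1 ≤ L)
    (hLz : 2 ≤ z * L ^ 2) (hα : ∀ i, |α i| ≤ B * L ^ i) (hβ : ∀ i, |β i| ≤ B * L ^ i) {x y : ℂ}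
    (hx : L * ‖x‖ < 1) (hy : L * ‖y‖ < 1) :
    Summable fun m : ℕ × ℕ => ‖(quotientCoeff z zr α β m.1 m.2 : ℂ) * x ^ m.1 * y ^ m.2‖ := by
  have hL0 : 0 < L := by linarith
  have h1 := ((summable_geometric_of_lt_one (by positivity) hx).mul_of_nonneg
    (summable_geometric_of_lt_one (by positivity) hy) (fun _ => by positivity)
    (fun _ => by positivity)).mul_left (2 * B / z)
  refine Summable.of_nonneg_of_le (fun _ => norm_nonneg _) (fun m => ?_) h1
  rw [norm_mul, norm_mul, norm_pow, norm_pow, Complex.norm_real, Real.norm_eq_abs]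
  calc _ ≤ 2 * B / z * (L ^ m.1 * L ^ m.2) * ‖x‖ ^ m.1 * ‖y‖ ^ m.2 := by
        gcongr
        exact h.abs_quotientCoeff_le hB hL hLz hα hβ _ _
    _ = _ := by rw [mul_pow, mul_pow]; ring

/-- The double power series with the coefficients `quotientCoeff` solves
`K(x,y) H(x,y) = f(x) - g(y)`. -/
lemma kernel_mul_tsum (h : IsModel z zr) {x y u v : ℂ} (hx : ‖x‖ ≤ 1) (hy : ‖y‖ ≤ 1)
    (hs : Summable fun m : ℕ × ℕ => ‖(quotientCoeff z zr α β m.1 m.2 : ℂ) * x ^ m.1 * y ^ m.2‖)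
    (hu : HasSum (fun i => (α i : ℂ) * x ^ i) u) (hv : HasSum (fun i => (β i : ℂ) * y ^ i) v) :
    kernel (weight z zr) x y *
      ∑' m : ℕ × ℕ, (quotientCoeff z zr α β m.1 m.2 : ℂ) * x ^ m.1 * y ^ m.2 = u - v := by
  set c := quotientCoeff z zr α β with hc
  have hS := hs.of_norm.hasSum
  set S := ∑' m : ℕ × ℕ, (c m.1 m.2 : ℂ) * x ^ m.1 * y ^ m.2 with hSdef
  have hconv := hasSum_prod_conv (h.summable_norm_term hx hy) hs
  rw [← hSdef, ← stepSeries] at hconv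
  have hz : (z : ℂ) ≠ 0 := by exact_mod_cast h.pos.ne'
  -- the terms of the series with both exponents positive
  have hpos : HasSum (fun m : ℕ × ℕ => if m.1 = 0 ∨ m.2 = 0 then 0 else
      (z : ℂ) * ((c m.1 m.2 : ℂ) * x ^ m.1 * y ^ m.2)) (x * y * (S - stepSeries zr x y * S)) := by
    have hinj : Function.Injective fun m : ℕ × ℕ => (m.1 + 1, m.2 + 1) := by
      rintro ⟨a, b⟩ ⟨a', b'⟩ hh
      simpa using hh
    rw [← hinj.hasSum_iff]
    · refine (congrArg (HasSum · _) (funext fun m => ?_)).mp ((hS.sub hconv).mul_left (x * y))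
      have e : ∑ a ∈ Finset.range (m.1 + 1), ∑ b ∈ Finset.range (m.2 + 1),
          ((zr (a + b) : ℂ) * x ^ a * y ^ b) *
            ((c (m.1 - a) (m.2 - b) : ℂ) * x ^ (m.1 - a) * y ^ (m.2 - b)) =
          ((∑ a ∈ Finset.range (m.1 + 1), ∑ b ∈ Finset.range (m.2 + 1),
            zr (a + b) * c (m.1 - a) (m.2 - b) : ℝ) : ℂ) * (x ^ m.1 * y ^ m.2) := by
        push_cast
        simp only [Finset.sum_mul]
        refine Finset.sum_congr rfl fun a ha => Finset.sum_congr rfl fun b hb => ?_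
        rw [Finset.mem_range] at ha hb
        rw [← pow_mul_pow_sub x (Nat.lt_succ_iff.1 ha), ← pow_mul_pow_sub y (Nat.lt_succ_iff.1 hb)]
        ring
      simp only [Function.comp, e]
      rw [if_neg (by omega), hc, quotientCoeff_succ_succ, Complex.ofReal_div, Complex.ofReal_sub]
      field_simp
      ring
    · rintro ⟨a, b⟩ hab
      rw [if_pos]
      rcases a with _ | a
      · exact Or.inl rfl
      rcases b with _ | b
      · exact Or.inr rfl
      exact absurd ⟨(a, b), rfl⟩ hab
  have hx0 : HasSum (fun m : ℕ × ℕ => if m.2 = 0 then (α m.1 : ℂ) * x ^ m.1 else 0) u := by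
    have hinj : Function.Injective fun i : ℕ => (i, 0) := fun a b hh => by simpa using hh
    rw [← hinj.hasSum_iff]
    · simpa [Function.comp_def] using hu
    · rintro ⟨a, b⟩ hab
      rw [if_neg]
      rintro rfl
      exact hab ⟨a, rfl⟩
  have hy0 : HasSum (fun m : ℕ × ℕ => if m.1 = 0 then (β m.2 : ℂ) * y ^ m.2 else 0) v := by
    have hinj : Function.Injective fun i : ℕ => (0, i) := fun a b hh => by simpa using hh
    rw [← hinj.hasSum_iff]
    · simpa [Function.comp_def] using hv
    · rintro ⟨a, b⟩ hab
      rw [if_neg]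
      rintro rfl
      exact hab ⟨b, rfl⟩
  have hall : HasSum (fun m : ℕ × ℕ => (z : ℂ) * ((c m.1 m.2 : ℂ) * x ^ m.1 * y ^ m.2))
      (x * y * (S - stepSeries zr x y * S) - (u - v)) := by
    refine (congrArg (HasSum · _) (funext fun m => ?_)).mp (hpos.sub (hx0.sub hy0))
    obtain ⟨i, j⟩ := m
    rcases i with _ | i <;> rcases j with _ | j
    · simp [hc, quotientCoeff]; field_simp
    · simp [hc, quotientCoeff]; field_simp
    · simp [hc, quotientCoeff]; field_simp
    · simp
  have hfin := hall.unique (hS.mul_left (z : ℂ))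
  rw [h.kernel_eq hx hy]
  linear_combination hfin

/-- For `f` and `g` with real power series at the origin, `(f(x) - g(y)) / K(x,y)` is the
generating function of a harmonic function. -/
lemma exists_harmonic (h : IsModel z zr) {f g : ℂ → ℂ} (hf : AnalyticAt ℂ f 0)
    (hg : AnalyticAt ℂ g 0)
    (hfc : ∀ᶠ x in 𝓝 (0 : ℂ), f (starRingEnd ℂ x) = starRingEnd ℂ (f x))
    (hgc : ∀ᶠ x in 𝓝 (0 : ℂ), g (starRingEnd ℂ x) = starRingEnd ℂ (g x)) :
    ∃ H : ℤ → ℤ → ℝ, IsQuadrantHarmonic (weight z zr) H ∧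
      ∀ᶠ q : ℂ × ℂ in 𝓝 (0, 0),
        HasSum (genTerm H q.1 q.2) ((f q.1 - g q.2) / kernel (weight z zr) q.1 q.2) := by
  obtain ⟨α, B₁, L₁, hB₁, hL₁, hα, hαs⟩ := exists_real_coeff hf hfc
  obtain ⟨β, B₂, L₂, hB₂, hL₂, hβ, hβs⟩ := exists_real_coeff hg hgc
  have hz := h.pos
  obtain ⟨B, hB⟩ : ∃ B, B = B₁ + B₂ := ⟨_, rfl⟩
  -- the summand `2 / z` makes the growth rate large enough for the recursion
  obtain ⟨L, hL⟩ : ∃ L, L = L₁ + L₂ + 2 / z := ⟨_, rfl⟩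
  have hzz : 0 < 2 / z := by positivity
  have hL1 : 1 ≤ L := by linarith
  have hLz : 2 ≤ z * L ^ 2 := by
    have h1 : 2 / z ≤ L := by linarith
    have h2 : z * (2 / z) ≤ z * L := mul_le_mul_of_nonneg_left h1 hz.le
    rw [mul_div_cancel₀ _ hz.ne'] at h2
    nlinarith
  have hα' : ∀ i, |α i| ≤ B * L ^ i := fun i => (hα i).trans (by
    gcongr <;> linarith)
  have hβ' : ∀ i, |β i| ≤ B * L ^ i := fun i => (hβ i).trans (by
    gcongr <;> linarith)
  refine ⟨_, h.isQuadrantHarmonic_shiftedCoeff α β, ?_⟩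
  have hL0 : 0 < L := by linarith
  have hsmall : ∀ᶠ x in 𝓝 (0 : ℂ), L * ‖x‖ < 1 ∧ 2 * ‖x‖ < z := by
    have h1 : Tendsto (fun x : ℂ => L * ‖x‖) (𝓝 0) (𝓝 0) := by
      simpa using (Continuous.tendsto (by fun_prop : Continuous fun x : ℂ => L * ‖x‖) 0)
    have h2 : Tendsto (fun x : ℂ => 2 * ‖x‖) (𝓝 0) (𝓝 0) := by
      simpa using (Continuous.tendsto (by fun_prop : Continuous fun x : ℂ => 2 * ‖x‖) 0)
    exact (h1.eventually_lt_const one_pos).and (h2.eventually_lt_const hz)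
  rw [nhds_prod_eq]
  filter_upwards [(hsmall.and hαs).prod_mk (hsmall.and hβs)] with q hq
  obtain ⟨⟨⟨hx, hxz⟩, hu⟩, ⟨⟨hy, -⟩, hv⟩⟩ := hq
  have hx1 : ‖q.1‖ ≤ 1 := (le_mul_of_one_le_left (norm_nonneg _) hL1).trans hx.le
  have hy1 : ‖q.2‖ ≤ 1 := (le_mul_of_one_le_left (norm_nonneg _) hL1).trans hy.le
  have hs := h.summable_quotient (by linarith) hL1 hLz hα' hβ' hx hy
  have hK : kernel (weight z zr) q.1 q.2 ≠ 0 := by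
    rw [h.kernel_eq hx1 hy1]
    intro h0
    have h1 : q.1 * q.2 * (1 - stepSeries zr q.1 q.2) = z := by linear_combination h0
    have h2 := congrArg norm h1
    rw [norm_mul, norm_mul, Complex.norm_real, Real.norm_of_nonneg hz.le] at h2
    have h3 : ‖1 - stepSeries zr q.1 q.2‖ ≤ 2 := by
      refine (norm_sub_le _ _).trans ?_
      rw [norm_one]
      linarith [h.norm_stepSeries_le hx1 hy1]
    have h4 : ‖q.1‖ * ‖q.2‖ * ‖1 - stepSeries zr q.1 q.2‖ ≤ ‖q.1‖ * 1 * 2 := by gcongr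
    linarith
  rw [← h.kernel_mul_tsum hx1 hy1 hs hu hv, mul_div_cancel_left₀ _ hK]
  refine (congrArg (HasSum · _) (funext fun m => ?_)).mp hs.of_norm.hasSum
  simp only [genTerm, shiftedCoeff_natCast]

end IsModel

/-! ### The explicit harmonic functions -/

lemma regularI0_conj (z : ℝ) (zr : ℕ → ℝ) (x : ℂ) :
    regularI0 z zr (starRingEnd ℂ x) = starRingEnd ℂ (regularI0 z zr x) := by
  rcases eq_or_ne x 0 with rfl | hx
  · simp [regularI0_zero]
  · rw [← mul_I0 z zr hx, ← mul_I0 z zr (by simpa using hx), I0_conj, map_mul]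

lemma ratioExt_conj (z : ℝ) (zr : ℕ → ℝ) (t : ℝ) (x : ℂ) :
    ratioExt z zr t (starRingEnd ℂ x) = starRingEnd ℂ (ratioExt z zr t x) := by
  have h1 : ∀ s : ℝ, starRingEnd ℂ (I0 z zr s) = I0 z zr s := fun s => by
    rw [← I0_conj, Complex.conj_ofReal]
  have h2 := h1 1
  rw [Complex.ofReal_one] at h2
  simp only [ratioExt, regularI0_conj, map_div₀, map_sub, map_mul, h1, h2]

lemma rho_of_ne (z : ℝ) (zr : ℕ → ℝ) (t : ℝ) {x : ℂ} (hx : x ≠ 0) :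
    rho z zr t x = z * ratio z zr t x ^ (1 / 2 : ℂ) := by
  rw [rho, Function.update_of_ne hx, rhoFormula]

lemma rho_pow (z : ℝ) (zr : ℕ → ℝ) (t : ℝ) (n : ℕ) {x : ℂ} (hx : x ≠ 0) :
    rho z zr t x ^ n = z ^ n * ratio z zr t x ^ ((n : ℂ) / 2) := by
  rw [rho_of_ne z zr t hx, mul_pow, ← Complex.cpow_nat_mul, mul_one_div]

lemma neg_neg_one_pow {n : ℕ} (hn : 1 ≤ n) : -(-1 : ℂ) ^ n = (-1) ^ (n - 1) := by
  obtain ⟨m, rfl⟩ : ∃ m, n = m + 1 := ⟨n - 1, by omega⟩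
  rw [Nat.add_sub_cancel, pow_succ]
  ring

lemma aeval_polyP (z : ℝ) (n : ℕ) (w : ℂ) :
    Polynomial.aeval w (polyP z n) = (w ^ 2 - (z : ℂ) ^ 2) ^ (n / 2) * w ^ (n % 2) := by
  simp [polyP]

lemma aeval_polyP_neg (z : ℝ) (n : ℕ) (w : ℂ) :
    Polynomial.aeval (-w) (polyP z n) = (-1) ^ n * Polynomial.aeval w (polyP z n) := by
  rw [aeval_polyP, aeval_polyP, neg_sq, neg_pow w, neg_one_pow_eq_pow_mod_two (n := n)]
  ring

lemma aeval_polyP_rho (z : ℝ) (zr : ℕ → ℝ) (t : ℝ) (n : ℕ) {x : ℂ} (hx : x ≠ 0) :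
    Polynomial.aeval (rho z zr t x) (polyP z n) = z ^ n * explicitP z zr t n x := by
  have h1 : rho z zr t x ^ 2 = z ^ 2 * ratio z zr t x := by
    rw [rho_of_ne z zr t hx, mul_pow, cpow_half_sq]
  have h2 : (z : ℂ) ^ n = (z ^ 2) ^ (n / 2) * z ^ (n % 2) := by
    rw [← pow_mul, ← pow_add, Nat.div_add_mod]
  rw [aeval_polyP, h1, rho_pow z zr t _ hx, explicitP, h2, ← mul_sub_one, mul_pow]
  ring

namespace IsModel

variable {z : ℝ} {zr : ℕ → ℝ} {t : ℝ}

lemma div_kernel (h : IsModel z zr) {x y : ℂ} (hx : ‖x‖ ≤ 1) (hy : ‖y‖ ≤ 1) (hx0 : x ≠ 0)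
    (hy0 : y ≠ 0) (hxy : x ≠ y) (A : ℂ) :
    A / kernel (weight z zr) x y = (y - x) * A / (x * y * (I0 z zr y - I0 z zr x)) := by
  rw [← h.kernel_mul_sub hx hy hx0 hy0, mul_comm (y - x) A,
    mul_div_mul_right _ _ (sub_ne_zero.2 hxy.symm)]

lemma analyticAt_rho (h : IsModel z zr) (ht0 : t < 0) (ht : (t : ℂ) ∈ curveS (weight z zr)) :
    AnalyticAt ℂ (rho z zr t) 0 :=
  DifferentiableOn.analyticAt (fun _ hx =>
    (h.differentiableAt_rho ht0 ht hx).differentiableWithinAt)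
    (h.isOpen_starDomain.mem_nhds h.zero_mem_starDomain)

lemma rho_conj (h : IsModel z zr) (ht0 : t < 0) (ht : (t : ℂ) ∈ curveS (weight z zr)) {x : ℂ}
    (hx : x ∈ starDomain z zr) :
    rho z zr t (starRingEnd ℂ x) = starRingEnd ℂ (rho z zr t x) := by
  rw [rho_eq h.pos, rho_eq h.pos, ratioExt_conj, map_mul, Complex.conj_ofReal,
    Complex.conj_cpow _ _ (Complex.slitPlane_arg_ne_pi (h.ratioExt_mem_slitPlane ht0 ht hx))]
  simp only [map_div₀, map_one, map_ofNat]

/-- Every real polynomial `P` gives a harmonic function with generating function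
`(P(ρ(x)) - P(-ρ(y))) / K(x,y)`. -/
lemma exists_harmonic_of_polynomial (h : IsModel z zr) (ht0 : t < 0)
    (ht : (t : ℂ) ∈ curveS (weight z zr)) (P : Polynomial ℝ) :
    ∃ H : ℤ → ℤ → ℝ, IsQuadrantHarmonic (weight z zr) H ∧
      ∀ᶠ q : ℂ × ℂ in 𝓝 (0, 0), HasSum (genTerm H q.1 q.2)
        ((Polynomial.aeval (rho z zr t q.1) P - Polynomial.aeval (-rho z zr t q.2) P) /
          kernel (weight z zr) q.1 q.2) := by
  have h1 := h.analyticAt_rho ht0 ht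
  have h2 : ∀ᶠ x in 𝓝 (0 : ℂ), rho z zr t (starRingEnd ℂ x) = starRingEnd ℂ (rho z zr t x) := by
    filter_upwards [h.isOpen_starDomain.mem_nhds h.zero_mem_starDomain] with x hx
      using h.rho_conj ht0 ht hx
  refine h.exists_harmonic (f := fun x => Polynomial.aeval (rho z zr t x) P)
    (g := fun x => Polynomial.aeval (-rho z zr t x) P) (h1.aeval_polynomial P)
    (h1.neg.aeval_polynomial P) ?_ ?_
  · filter_upwards [h2] with x hx
    rw [hx, Polynomial.aeval_conj]
  · filter_upwards [h2] with x hx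
    rw [hx, ← map_neg, Polynomial.aeval_conj]

lemma eventually_norm_le_one :
    ∀ᶠ q : ℂ × ℂ in 𝓝 (0, 0), ‖q.1‖ ≤ 1 ∧ ‖q.2‖ ≤ 1 := by
  have h1 : Metric.closedBall (0 : ℂ) 1 ∈ 𝓝 (0 : ℂ) := Metric.closedBall_mem_nhds 0 one_pos
  filter_upwards [prod_mem_nhds h1 h1] with q hq
  simpa using hq

end IsModel

end QuadrantWalk

end

theorem mainTheorem7 (z : ℝ) (zr : ℕ → ℝ) (hz : 0 < z) (hzr : ∀ r, 0 ≤ zr r)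
    (hmass : HasSum (fun r : ℕ => ((r : ℝ) + 1) * zr r) (1 - z))
    (hdrift : HasSum (fun r : ℕ => zr r * ((r : ℝ) * ((r : ℝ) + 1) / 2)) z) :
    ∃ t : ℝ, t ≠ 1 ∧
      -- `1` and `t` are the real points of the curve
      (∀ s : ℝ, (s : ℂ) ∈ QuadrantWalk.curveS (QuadrantWalk.weight z zr) ↔ s = 1 ∨ s = t) ∧
      -- `t` is the only critical point of `I₀` in `[-1, 1)`
      (t < 1 ∧ -1 ≤ t ∧ ∀ s : ℝ, -1 ≤ s → s < 1 →
        (HasDerivWithinAt (QuadrantWalk.I0 z zr) 0 (Metric.closedBall 0 1) (s : ℂ) ↔ s = t)) ∧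
      -- `ρ` is conformal from the inside of the curve onto the right half-plane
      QuadrantWalk.IsConformalOnto (QuadrantWalk.rho z zr t)
        (QuadrantWalk.insideS (QuadrantWalk.weight z zr)) QuadrantWalk.rightHalfPlane ∧
      -- and it sends `0` to `z`
      ((0 : ℂ) ∈ QuadrantWalk.insideS (QuadrantWalk.weight z zr) ∧
        QuadrantWalk.rho z zr t 0 = (z : ℂ) ∧
        Tendsto (QuadrantWalk.rhoFormula z zr t) (𝓝[≠] 0) (𝓝 (z : ℂ))) ∧
      -- hence `ρ` is the normalized conformal mapping `ψ₁`
      (QuadrantWalk.IsNormalizedMapping (QuadrantWalk.weight z zr) (QuadrantWalk.rho z zr t) ∧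
        ∀ ψ : ℂ → ℂ, QuadrantWalk.IsNormalizedMapping (QuadrantWalk.weight z zr) ψ →
          Set.EqOn ψ (QuadrantWalk.rho z zr t)
            (QuadrantWalk.insideS (QuadrantWalk.weight z zr))) ∧
      -- explicit harmonic functions given by the monomials `X^n`
      (∀ n : ℕ, 1 ≤ n → ∃ h : ℤ → ℤ → ℝ,
        QuadrantWalk.IsQuadrantHarmonic (QuadrantWalk.weight z zr) h ∧
        ∀ᶠ q : ℂ × ℂ in 𝓝 (0, 0), q.1 ≠ 0 → q.2 ≠ 0 → q.1 ≠ q.2 →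
          HasSum (QuadrantWalk.genTerm h q.1 q.2)
            (QuadrantWalk.monomialSeries z zr t n q.1 q.2)) ∧
      -- explicit generating functions `H_n` of the `h_n`, given by the polynomials `P_n`
      (∀ n : ℕ, 1 ≤ n → ∃ h : ℤ → ℤ → ℝ,
        QuadrantWalk.IsQuadrantHarmonic (QuadrantWalk.weight z zr) h ∧
        ∀ᶠ q : ℂ × ℂ in 𝓝 (0, 0),
          HasSum (QuadrantWalk.genTerm h q.1 q.2)
            ((Polynomial.aeval (QuadrantWalk.rho z zr t q.1) (QuadrantWalk.polyP z n) -
                Polynomial.aeval (-QuadrantWalk.rho z zr t q.2) (QuadrantWalk.polyP z n)) /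
              QuadrantWalk.kernel (QuadrantWalk.weight z zr) q.1 q.2) ∧
          (q.1 ≠ 0 → q.2 ≠ 0 → q.1 ≠ q.2 →
            HasSum (QuadrantWalk.genTerm h q.1 q.2)
              (QuadrantWalk.polySeries z zr t n q.1 q.2))) := by 
  have h : QuadrantWalk.IsModel z zr := ⟨hz, hzr, hmass, hdrift⟩
  obtain ⟨t, ht1, ht0, ht⟩ := h.exists_neg_mem_curveS
  have hab := h.I0_lt_I0_one ht0 ht
  have hconf := h.isConformalOnto_rho ht0 ht
  have hrho0 : QuadrantWalk.rho z zr t 0 = (z : ℂ) := by simp [QuadrantWalk.rho]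
  have hw : QuadrantWalk.weight z zr 1 1 = z := by simp [QuadrantWalk.weight]
  rw [h.insideS_eq]
  refine ⟨t, by linarith, h.ofReal_mem_curveS_iff ht0 ht, ⟨by linarith, ht1, fun s hs1 hs2 =>
    h.hasDerivWithinAt_zero_iff ht0 ht hs1 hs2⟩, hconf, ⟨h.zero_mem_starDomain, hrho0,
    h.tendsto_rhoFormula⟩, ⟨⟨?_, ?_, ?_⟩, ?_⟩, ?_, ?_⟩
  · rw [h.insideS_eq]; exact hconf
  · rw [hrho0, hw]
  · exact ⟨_, half_pos (sub_pos.2 hab), h.hasDerivAt_rho_zero⟩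
  · rintro ψ ⟨hψ, hψ0, c, hc, hψc⟩
    rw [h.insideS_eq] at hψ
    rw [hw] at hψ0
    exact QuadrantWalk.eqOn_of_isConformalOnto h.isOpen_starDomain hz h.zero_mem_starDomain hψ hconf
      hψ0 hrho0 hc (half_pos (sub_pos.2 hab)) hψc h.hasDerivAt_rho_zero
  · intro n hn
    obtain ⟨H, hH, hs⟩ := h.exists_harmonic_of_polynomial ht0 ht (Polynomial.X ^ n)
    refine ⟨H, hH, ?_⟩
    filter_upwards [hs, QuadrantWalk.IsModel.eventually_norm_le_one] with q hq hq1 hx hy hxy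
    rw [h.div_kernel hq1.1 hq1.2 hx hy hxy] at hq
    convert hq using 1
    rw [QuadrantWalk.monomialSeries, map_pow, map_pow, Polynomial.aeval_X, Polynomial.aeval_X,
      neg_pow (QuadrantWalk.rho z zr t q.2), QuadrantWalk.rho_pow z zr t n hx,
      QuadrantWalk.rho_pow z zr t n hy,
      ← QuadrantWalk.neg_neg_one_pow hn]
    ring
  · intro n hn
    obtain ⟨H, hH, hs⟩ := h.exists_harmonic_of_polynomial ht0 ht (QuadrantWalk.polyP z n)
    refine ⟨H, hH, ?_⟩
    filter_upwards [hs, QuadrantWalk.IsModel.eventually_norm_le_one] with q hq hq1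
    refine ⟨hq, fun hx hy hxy => ?_⟩
    rw [h.div_kernel hq1.1 hq1.2 hx hy hxy] at hq
    convert hq using 1
    rw [QuadrantWalk.polySeries, QuadrantWalk.aeval_polyP_neg,
      QuadrantWalk.aeval_polyP_rho z zr t n hx, QuadrantWalk.aeval_polyP_rho z zr t n hy,
      ← QuadrantWalk.neg_neg_one_pow hn]
    ring
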